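/- Setting. Let $\Omega\subset\mathbb R^2$ be a bounded open polygonal domain, and let $\mathscr T_h$ be a geometrically conforming triangulation of $\Omega$ which is shape regular with parameter $\sigma>0$ (each triangle $K$, of diameter $h_K$, contains a ball of radius $h_K/\sigma$), with edge set $\mathscr E_h$. Let $V_h$ and $Z_h$ be the spaces of functions in $C(\overline\Omega)$ that are polynomials of degree at most 1, respectively at most 2, on each $K\in\mathscr T_h$. For an interior edge $e$ shared by $K_\pm$, with unit normal $n_e$ pointing from $K_-$ to $K_+$, put $[\![\partial_{n_e} v]\!]=n_e\cdot(\nabla v_+-\nabla v_-)$ and $\{\!\{\partial^2_{n_e}v\}\!\}=\tfrac12 n_e\cdot(\nabla^2v_-+\nabla^2v_+)n_e$; for a boundary edge of $K$, with $n_e$ pointing out of $\Omega$, put $[\![\partial_{n_e} v]\!]=-n_e\cdot\nabla v_K$ and $\{\!\{\partial^2_{n_e}v\}\!\}=n_e\cdot(\nabla^2v_K)n_e$. With a penalty parameter $\alpha\ge1$ let $$a_h(w,v)=\sum_{K}\int_K\nabla^2w:\nabla^2v\,dx+\sum_{e}\int_e\Big(\{\!\{\partial^2_{n_e}w\}\!\}[\![\partial_{n_e}v]\!]+\{\!\{\partial^2_{n_e}v\}\!\}[\![\partial_{n_e}w]\!]\Big)dS+\alpha\sum_e\frac1{|e|}\int_e[\![\partial_{n_e}w]\!][\![\partial_{n_e}v]\!]\,dS,$$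 $$\|v\|_{2,h}^2=\sum_K|v|_{H^2(K)}^2+\sum_e\frac{\alpha}{|e|}\big\|[\![\partial_{n_e}v]\!]\big\|_{L^2(e)}^2,$$ where $\sum_K$ and $\sum_e$ run over $K\in\mathscr T_h$ and $e\in\mathscr E_h$ and $|v|_{H^2(K)}^2=\int_K\nabla^2v:\nabla^2v\,dx$, and $$F(u)=\tfrac14\|u\|_{L^4}^4+\tfrac{1-\epsilon}2\|u\|_{L^2}^2-\|\nabla u\|_{L^2}^2+\tfrac12a_h(u,u),$$ all norms and the inner product $(\cdot,\cdot)$ being over $\Omega$ unless indicated. For $\tau>0$, $M\ge1$, $T=M\tau$ and $\phi_h^0\in Z_h$, a discrete solution consists of $(\phi_h^m,\mu_h^m)\in Z_h\times V_h$, $1\le m\le M$, such that, with $\delta_\tau\phi_h^m=(\phi_h^m-\phi_h^{m-1})/\tau$, $$(\delta_\tau\phi_h^m,\nu)+(\nabla\mu_h^m,\nabla\nu)=0\quad\forall\nu\in V_h,$$ $$a_h(\phi_h^m,\psi)+\big((\phi_h^m)^3+(1-\epsilon)\phi_h^m,\psi\big)-2(\nabla\phi_h^{m-1},\nabla\psi)-(\mu_h^m,\psi)=0\quad\forall\psi\in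 Z_h.$$ A number $C_{coer}>0$ is called a coercivity constant of $a_h$ if $C_{coer}\|w\|_{2,h}^2\le a_h(w,w)$ for all $w\in Z_h$. Statement. Let $\sigma>0$. (i) There are $C_{coer}>0$ and $\alpha_1\ge1$, depending only on $\sigma$, such that $C_{coer}$ is a coercivity constant of $a_h$ for every bounded polygonal domain $\Omega$, every triangulation of $\Omega$ that is shape regular with parameter $\sigma$, and every $\alpha\ge\alpha_1$. (ii) Let $\Omega$ be a bounded polygonal domain, $C_{coer}>0$ and $\gamma>0$. There is $\alpha_0\ge1$, depending only on $\sigma,\Omega,C_{coer},\gamma$, such that for all $\alpha\ge\alpha_0$, all $\epsilon<1$ with $$\epsilon<1+\frac{(1-\gamma)C_{coer}-1}{C_{coer}},$$ and all $C_0\in\mathbb R$ there is a constant $C$ (independent of $\mathscr T_h$, hence of $h$, and of $\tau$, $M$ and $T$) with the following property. For every triangulation of $\Omega$ that is shape regular with parameter $\sigma$ and for which $C_{coer}$ is a coercivity constant of $a_h$, all $\tau>0$ and $M\ge1$, and every discrete solution with $F(\phi_h^0)\le C_0$, $$\max_{0\le m\le M}\Big[\|\phi_h^m\|_{L^4}^2+\|\phi_h^m\|_{L^2}^2+\|\phi_h^m\|_{H^1}^2+\|\phi_h^m\|_{2,h}^2\Big]\le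 C,$$ and for all $1\le\ell\le M$ $$\tau\sum_{m=1}^\ell\|\nabla\mu_h^m\|_{L^2}^2\le C,\qquad \tau^2\sum_{m=1}^\ell\Big\{\|\nabla\delta_\tau\phi_h^m\|_{L^2}^2+\|\phi_h^m\,\delta_\tau\phi_h^m\|_{L^2}^2+\|\delta_\tau\phi_h^m\|_{2,h}^2\Big\}\le C.$$ -/

import Mathlib

open MeasureTheory
open scoped RealInnerProductSpace ENNReal

noncomputable section

namespace PFC

/-- The Euclidean plane `ℝ²`. -/
abbrev Plane := EuclideanSpace ℝ (Fin 2)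

/-- An open bounded polygonal domain: bounded, open and connected, lying on one side of its boundary
(no slits), with a boundary that is a finite union of line segments. -/
structure IsPolygonalDomain (Ω : Set Plane) : Prop where
  isOpen : IsOpen Ω
  isConnected : IsConnected Ω
  isBounded : Bornology.IsBounded Ω
  interior_closure : interior (closure Ω) = Ω
  frontier_eq : ∃ S : Finset (Plane × Plane), frontier Ω = ⋃ p ∈ S, segment ℝ p.1 p.2

/-- A geometrically conforming triangulation of `Ω`: a finite simplicial complex with underlying
space `closure Ω`, all of whose faces are faces of triangles. A triangle, an edge or a vertex is
given by the finite set of its vertices. -/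
structure Triangulation (Ω : Set Plane) extends Geometry.SimplicialComplex ℝ Plane where
  finite_faces : faces.Finite
  pure : ∀ s ∈ faces, ∃ K ∈ faces, s ⊆ K ∧ K.card = 3
  space_eq : toSimplicialComplex.space = closure Ω

/-- The closed simplex (triangle, edge) with vertex set `s`. -/
def cell (s : Finset Plane) : Set Plane := convexHull ℝ (s : Set Plane)

/-- `∇ v_K` at `x ∈ K`, where `v_K` is the restriction of `v` to the closed triangle `K`. -/
def grad (K : Finset Plane) (v : Plane → ℝ) (x : Plane) : Plane :=
  gradientWithin v (cell K) x

/-- `∇² v_K` at `x ∈ K`, as a linear map. -/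
def hess (K : Finset Plane) (v : Plane → ℝ) (x : Plane) : Plane →L[ℝ] Plane :=
  fderivWithin ℝ (grad K v) (cell K) x

/-- The Frobenius product `A : B`. -/
def frob (A B : Plane →L[ℝ] Plane) : ℝ :=
  ∑ i : Fin 2, ⟪A (EuclideanSpace.single i 1), B (EuclideanSpace.single i 1)⟫

/-- `n` is the unit normal of the edge `e` of the triangle `K` which points out of `K`. -/
def IsOutwardNormal (K e : Finset Plane) (n : Plane) : Prop :=
  ‖n‖ = 1 ∧ ∀ x ∈ K, ∀ y ∈ e, ⟪n, x - y⟫ ≤ 0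

/-- The outward unit normal of the edge `e` of the triangle `K`. -/
def outwardNormal (K e : Finset Plane) : Plane := Classical.epsilon (IsOutwardNormal K e)

/-- A triangle has an outward unit normal on each of its edges. -/
theorem isOutwardNormal_outwardNormal {K e : Finset Plane}
    (hK : AffineIndependent ℝ ((↑) : K → Plane)) (hK3 : K.card = 3) (he : e ⊆ K)
    (he2 : e.card = 2) : IsOutwardNormal K e (outwardNormal K e) := by
  classical
  apply Classical.epsilon_spec (p := IsOutwardNormal K e)
  obtain ⟨c, hc⟩ := Finset.card_eq_one.1
    (show (K \ e).card = 1 by rw [Finset.card_sdiff_of_subset he, hK3, he2])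
  have hcK : c ∈ K \ e := by rw [hc]; simp
  rw [Finset.mem_sdiff] at hcK
  obtain ⟨a, ha⟩ : e.Nonempty := Finset.card_pos.1 (by omega)
  have hc' : c ∉ affineSpan ℝ (e : Set Plane) := by
    have := hK.notMem_affineSpan_sdiff ⟨c, hcK.1⟩ {x : K | (x : Plane) ∈ e}
    intro h
    apply this
    convert h using 2
    ext x
    simp only [Set.mem_image, Set.mem_sdiff, Set.mem_ofPred_eq, Set.mem_singleton_iff]
    constructor
    · rintro ⟨y, ⟨hy, -⟩, rfl⟩
      exact hy
    · intro hx
      refine ⟨⟨x, he hx⟩, ⟨hx, ?_⟩, rfl⟩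
      intro h
      have hxc : x = c := congrArg Subtype.val h
      exact hcK.2 (hxc ▸ hx)
  have : Nonempty (affineSpan ℝ (e : Set Plane)) := ⟨⟨a, subset_affineSpan ℝ _ ha⟩⟩
  set P : Plane := (EuclideanGeometry.orthogonalProjection (affineSpan ℝ (e : Set Plane)) c : Plane)
    with hP
  have hPmem : P ∈ affineSpan ℝ (e : Set Plane) :=
    EuclideanGeometry.orthogonalProjection_mem c
  have hne : P - c ≠ 0 := by
    intro h
    exact hc' (by rw [← sub_eq_zero.1 h]; exact hPmem)
  have horth : ∀ x ∈ affineSpan ℝ (e : Set Plane), ∀ y ∈ affineSpan ℝ (e : Set Plane),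
      ⟪P - c, x - y⟫ = 0 := by
    intro x hx y hy
    have h1 := EuclideanGeometry.orthogonalProjection_vsub_mem_direction_orthogonal
      (affineSpan ℝ (e : Set Plane)) c
    exact Submodule.inner_left_of_mem_orthogonal (AffineSubspace.vsub_mem_direction hx hy) h1
  refine ⟨‖P - c‖⁻¹ • (P - c), ?_, ?_⟩
  · rw [norm_smul, norm_inv, norm_norm, inv_mul_cancel₀ (norm_ne_zero_iff.2 hne)]
  · intro x hx y hy
    rw [real_inner_smul_left]
    apply mul_nonpos_of_nonneg_of_nonpos (by positivity)
    have hy' := subset_affineSpan ℝ (e : Set Plane) hy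
    by_cases hxe : x ∈ e
    · exact (horth x (subset_affineSpan ℝ _ hxe) y hy').le
    · have hxc : x = c := by
        have : x ∈ K \ e := Finset.mem_sdiff.2 ⟨hx, hxe⟩
        rw [hc] at this
        simpa using this
      rw [hxc, show c - y = -(P - c) + (P - y) by abel, inner_add_right, inner_neg_right,
        horth P hPmem y hy']
      have := real_inner_self_nonneg (x := P - c)
      linarith

namespace Triangulation

variable {Ω : Set Plane} (T : Triangulation Ω)

/-- The set of the triangles of the triangulation. -/
def triangles : Finset (Finset Plane) := T.finite_faces.toFinset.filter fun K => K.card = 3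

/-- The set of the edges of the triangles. -/
def edges : Finset (Finset Plane) := T.finite_faces.toFinset.filter fun e => e.card = 2

open Classical in
/-- The triangles which have `e` as an edge: two if `e` is interior, one if `e` is on the boundary. -/
def adjacent (e : Finset Plane) : Finset (Finset Plane) := T.triangles.filter fun K => e ⊆ K

/-- The jump of the normal derivative on the edge `e`, namely minus the sum, over the triangles `K`
at `e`, of the derivative of `v_K` in the direction `n_K` pointing out of `K`. On an interior edge
`e` between `K₋` and `K₊`, with `n_e = n_{K₋} = - n_{K₊}` pointing from `K₋` to `K₊`, this is
`n_e · (∇ v₊ - ∇ v₋)`. On a boundary edge it is `- n_e · ∇ v_K`. -/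
def jump (e : Finset Plane) (v : Plane → ℝ) (x : Plane) : ℝ :=
  -∑ K ∈ T.adjacent e, ⟪outwardNormal K e, grad K v x⟫

/-- The average of the second normal derivative on the edge `e`: the mean of `n_e · (∇² v_K) n_e`
over the one or two triangles `K` at `e` (the sign of the normal is immaterial). -/
def avg (e : Finset Plane) (v : Plane → ℝ) (x : Plane) : ℝ :=
  ((T.adjacent e).card : ℝ)⁻¹ *
    ∑ K ∈ T.adjacent e, ⟪outwardNormal K e, hess K v x (outwardNormal K e)⟫

/-- The integral over the edge `e` with respect to arc length. -/
def edgeIntegral (e : Finset Plane) (f : Plane → ℝ) : ℝ :=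
  ∫ x in cell e, f x ∂(Measure.hausdorffMeasure 1 : Measure Plane)

/-- The length of the edge, or the diameter of the triangle, with vertex set `s`. -/
def diam (s : Finset Plane) : ℝ := Metric.diam (cell s)

/-- The interior penalty bilinear form with penalty parameter `α`. -/
def aIP (α : ℝ) (w v : Plane → ℝ) : ℝ :=
  (∑ K ∈ T.triangles, ∫ x in cell K, frob (hess K w x) (hess K v x))
    + (∑ e ∈ T.edges, edgeIntegral e fun x => T.avg e w x * T.jump e v x)
    + (∑ e ∈ T.edges, edgeIntegral e fun x => T.avg e v x * T.jump e w x)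
    + α * ∑ e ∈ T.edges, 1 / diam e * edgeIntegral e fun x => T.jump e w x * T.jump e v x

/-- The square of the mesh dependent norm `‖v‖_{2,h}`. -/
def normSq2h (α : ℝ) (v : Plane → ℝ) : ℝ :=
  (∑ K ∈ T.triangles, ∫ x in cell K, frob (hess K v x) (hess K v x))
    + ∑ e ∈ T.edges, α / diam e * edgeIntegral e fun x => T.jump e v x ^ 2

/-- The Lagrange finite element space of degree `k`: functions which are continuous on `closure Ω`
and agree with a polynomial of degree at most `k` on each closed triangle (the values outside
`closure Ω` play no role). -/
def lagrange (k : ℕ) : Set (Plane → ℝ) :=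
  {v | ContinuousOn v (closure Ω) ∧ ∀ K ∈ T.triangles, ∃ p : MvPolynomial (Fin 2) ℝ,
    p.totalDegree ≤ k ∧ ∀ x ∈ cell K, v x = MvPolynomial.eval (fun i => x i) p}

/-- `V_h`, the Lagrange space of degree 1. -/
def Vh : Set (Plane → ℝ) := T.lagrange 1

/-- `Z_h`, the Lagrange space of degree 2. -/
def Zh : Set (Plane → ℝ) := T.lagrange 2

/-- Shape regularity with parameter `σ`: each triangle `K` contains a ball of radius `h_K / σ`. -/
def ShapeRegular (σ : ℝ) : Prop :=
  ∀ K ∈ T.triangles, ∃ c : Plane, Metric.closedBall c (diam K / σ) ⊆ cell K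

/-- The bilinear form is coercive on `Z_h` with the constant `C`. -/
def Coercive (α C : ℝ) : Prop :=
  ∀ w ∈ T.Zh, C * T.normSq2h α w ≤ T.aIP α w w

end Triangulation

/-- The `L²(Ω)` inner product. -/
def ip (Ω : Set Plane) (u v : Plane → ℝ) : ℝ := ∫ x in Ω, u x * v x

/-- `(∇ u, ∇ v)` in `L²(Ω)`. The functions to which this is applied are continuous and piecewise
polynomial, so that the classical gradient exists off the edges and is the weak gradient. -/
def gradIp (Ω : Set Plane) (u v : Plane → ℝ) : ℝ := ∫ x in Ω, ⟪gradient u x, gradient v x⟫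

/-- The `L^p(Ω)` norm. -/
def normL {F : Type*} [NormedAddCommGroup F] (p : ℝ≥0∞) (Ω : Set Plane) (u : Plane → F) : ℝ :=
  lpNorm u p (volume.restrict Ω)

/-- The square of the `H¹(Ω)` norm. -/
def normSqH1 (Ω : Set Plane) (u : Plane → ℝ) : ℝ :=
  normL 2 Ω u ^ 2 + normL 2 Ω (gradient u) ^ 2

/-- The difference quotient `δ_τ φ^m = (φ^m - φ^{m-1}) / τ`, used for `m ≥ 1`. -/
def dq (τ : ℝ) (φ : ℕ → Plane → ℝ) (m : ℕ) : Plane → ℝ := fun x => (φ m x - φ (m - 1) x) / τ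

/-- The discrete energy `F`. -/
def energy {Ω : Set Plane} (T : Triangulation Ω) (α ε : ℝ) (u : Plane → ℝ) : ℝ :=
  1 / 4 * normL 4 Ω u ^ 4 + (1 - ε) / 2 * normL 2 Ω u ^ 2 - normL 2 Ω (gradient u) ^ 2
    + 1 / 2 * T.aIP α u u

/-- `(φ^m, μ^m)`, `1 ≤ m ≤ M`, solves the fully discrete scheme with time step `τ`, started from
`φ^0 ∈ Z_h`. -/
structure IsDiscreteSolution {Ω : Set Plane} (T : Triangulation Ω) (α ε τ : ℝ) (M : ℕ)
    (φ μ : ℕ → Plane → ℝ) : Prop where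
  phi_mem : ∀ m ≤ M, φ m ∈ T.Zh
  mu_mem : ∀ m, 1 ≤ m → m ≤ M → μ m ∈ T.Vh
  evolution : ∀ m, 1 ≤ m → m ≤ M → ∀ ν ∈ T.Vh,
    ip Ω (dq τ φ m) ν + gradIp Ω (μ m) ν = 0
  potential : ∀ m, 1 ≤ m → m ≤ M → ∀ ψ ∈ T.Zh,
    T.aIP α (φ m) ψ + ip Ω (fun x => φ m x ^ 3 + (1 - ε) * φ m x) ψ
      - 2 * gradIp Ω (φ (m - 1)) ψ - ip Ω (μ m) ψ = 0

end PFC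

end

/-! The scheme is a convex splitting: the convex part of the energy F is taken at the new time and
the concave term -‖∇u‖² at the old one. Testing the first equation with μ^m and the second with δ_τ
φ^m therefore makes F decrease, for every τ > 0, by at least τ‖∇μ^m‖² plus τ² times squared norms of
the increment; coercivity supplies the ‖·‖_{2,h} part of these. This is `energy_step`, summed over
the steps in `energy_law`.

It remains to bound F from below. For ε < 1 and a coercive form its only negative term is -‖∇u‖².
Green's formula on each triangle, summed over the mesh, turns ‖∇u‖² into -∫ uΔu plus edge terms, and
the continuity of u collapses the latter to -∫_e u⟦∂_n u⟧, boundary edges included. Young's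
inequality, with the inverse trace inequality for quadratics, gives ‖∇u‖² ≤ η‖u‖²_{2,h} +
(C(σ)/η)‖u‖² for every η > 0 (`gradIp_self_le`). With η = C_coer/4 the first term is absorbed by the
coercive part of F; the L⁴ norm absorbs any multiple of ‖u‖², at the price of a multiple of |Ω|
(`le_energy`). The constants involve only σ, C_coer, |Ω| and C₀, never the mesh or the time steps.

For part (i), `coercive_half`: Hessians of quadratics are constant on each triangle K, and the
inscribed ball gives |e|² ≤ (σ²/π)|K| for its edges e. Young's inequality then bounds the
consistency terms by half of the Hessian part plus a multiple of the jumps which a large penalty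
dominates. -/

noncomputable section

namespace PFC

/-! ### Quadratic polynomials of two variables and their derivatives. -/

/-- The quadratic polynomial in two variables with the given coefficients. -/
def quad (c : Fin 6 → ℝ) (x : Plane) : ℝ :=
  c 0 + c 1 * x 0 + c 2 * x 1 + c 3 * x 0 ^ 2 + c 4 * (x 0 * x 1) + c 5 * x 1 ^ 2

/-- The gradient of `quad c`. -/
def gradQ (c : Fin 6 → ℝ) (x : Plane) : Plane :=
  !₂[c 1 + 2 * c 3 * x 0 + c 4 * x 1, c 2 + c 4 * x 0 + 2 * c 5 * x 1]

/-- The Hessian of `quad c`. -/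
def hessQ (c : Fin 6 → ℝ) : Plane →L[ℝ] Plane :=
  LinearMap.toContinuousLinearMap
    { toFun := fun y => !₂[2 * c 3 * y 0 + c 4 * y 1, c 4 * y 0 + 2 * c 5 * y 1]
      map_add' := by
        intro x y
        ext i
        fin_cases i <;> simp <;> ring
      map_smul' := by
        intro r x
        ext i
        fin_cases i <;> simp <;> ring }

@[simp] theorem gradQ_zero (c : Fin 6 → ℝ) (x : Plane) :
    gradQ c x 0 = c 1 + 2 * c 3 * x 0 + c 4 * x 1 := by simp [gradQ]

@[simp] theorem gradQ_one (c : Fin 6 → ℝ) (x : Plane) :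
    gradQ c x 1 = c 2 + c 4 * x 0 + 2 * c 5 * x 1 := by simp [gradQ]

@[simp] theorem hessQ_zero (c : Fin 6 → ℝ) (x : Plane) :
    hessQ c x 0 = 2 * c 3 * x 0 + c 4 * x 1 := by simp [hessQ]

@[simp] theorem hessQ_one (c : Fin 6 → ℝ) (x : Plane) :
    hessQ c x 1 = c 4 * x 0 + 2 * c 5 * x 1 := by simp [hessQ]

theorem inner_plane (x y : Plane) : ⟪x, y⟫ = x 0 * y 0 + x 1 * y 1 := by
  rw [PiLp.inner_apply, Fin.sum_univ_two]
  simp [mul_comm]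

theorem contDiff_quad (c : Fin 6 → ℝ) : ContDiff ℝ 2 (quad c) := by
  unfold quad
  fun_prop

theorem continuous_quad (c : Fin 6 → ℝ) : Continuous (quad c) := (contDiff_quad c).continuous

theorem hasGradientAt_quad (c : Fin 6 → ℝ) (x : Plane) :
    HasGradientAt (quad c) (gradQ c x) x := by
  rw [hasGradientAt_iff_hasFDerivAt]
  have h0 : HasFDerivAt (fun y : Plane => y 0) (EuclideanSpace.proj (0 : Fin 2) : Plane →L[ℝ] ℝ) x :=
    (EuclideanSpace.proj (0 : Fin 2) : Plane →L[ℝ] ℝ).hasFDerivAt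
  have h1 : HasFDerivAt (fun y : Plane => y 1) (EuclideanSpace.proj (1 : Fin 2) : Plane →L[ℝ] ℝ) x :=
    (EuclideanSpace.proj (1 : Fin 2) : Plane →L[ℝ] ℝ).hasFDerivAt
  have := (((((hasFDerivAt_const (c 0) x).add (h0.const_mul (c 1))).add (h1.const_mul (c 2))).add
    ((h0.pow 2).const_mul (c 3))).add ((h0.mul h1).const_mul (c 4))).add
    ((h1.pow 2).const_mul (c 5))
  refine this.congr_fderiv ?_
  ext y
  simp [inner_plane]
  ring

theorem hasFDerivAt_gradQ (c : Fin 6 → ℝ) (x : Plane) : HasFDerivAt (gradQ c) (hessQ c) x := by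
  have : gradQ c = fun y => hessQ c y + !₂[c 1, c 2] := by
    funext y
    ext i
    fin_cases i <;> simp <;> ring
  rw [this]
  exact (hessQ c).hasFDerivAt.add_const _

theorem continuous_gradQ (c : Fin 6 → ℝ) : Continuous (gradQ c) :=
  continuous_iff_continuousAt.2 fun x => (hasFDerivAt_gradQ c x).continuousAt

theorem quad_add (c d : Fin 6 → ℝ) (x : Plane) : quad (c + d) x = quad c x + quad d x := by
  simp [quad]; ring

theorem quad_smul (r : ℝ) (c : Fin 6 → ℝ) (x : Plane) : quad (r • c) x = r * quad c x := by
  simp [quad]; ring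

theorem gradQ_add (c d : Fin 6 → ℝ) (x : Plane) : gradQ (c + d) x = gradQ c x + gradQ d x := by
  ext i
  fin_cases i <;> simp <;> ring

theorem gradQ_smul (r : ℝ) (c : Fin 6 → ℝ) (x : Plane) : gradQ (r • c) x = r • gradQ c x := by
  ext i
  fin_cases i <;> simp <;> ring

theorem hessQ_add (c d : Fin 6 → ℝ) : hessQ (c + d) = hessQ c + hessQ d := by
  ext x i
  fin_cases i <;> simp <;> ring

theorem hessQ_smul (r : ℝ) (c : Fin 6 → ℝ) : hessQ (r • c) = r • hessQ c := by
  ext x i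
  fin_cases i <;> simp <;> ring

/-- A polynomial of degree at most two is a quadratic polynomial. -/
theorem exists_quad_of_totalDegree_le {p : MvPolynomial (Fin 2) ℝ} (hp : p.totalDegree ≤ 2) :
    ∃ c, ∀ x : Plane, MvPolynomial.eval (fun i => x i) p = quad c x := by
  have key : ∀ S : Finset (Fin 2 →₀ ℕ), (∀ d ∈ S, d 0 + d 1 ≤ 2) →
      ∃ c, ∀ x : Plane, ∑ d ∈ S, p.coeff d * (x 0 ^ d 0 * x 1 ^ d 1) = quad c x := by
    intro S
    induction S using Finset.induction_on with
    | empty => exact fun _ => ⟨0, fun x => by simp [quad]⟩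
    | insert d S hd ih =>
      intro h
      obtain ⟨c, hc⟩ := ih fun e he => h e (Finset.mem_insert_of_mem he)
      have hd2 := h d (Finset.mem_insert_self _ _)
      obtain ⟨b, hb⟩ : ∃ b, ∀ x : Plane, x 0 ^ d 0 * x 1 ^ d 1 = quad b x := by
        generalize d 0 = m at hd2 ⊢
        generalize d 1 = n at hd2 ⊢
        have hm : m ≤ 2 := by omega
        have hn : n ≤ 2 := by omega
        -- Of the nine pairs of exponents at most 2, three have total degree above 2; the others are
        -- the six basis monomials of `quad`.
        interval_cases m <;> interval_cases n <;> first
          | omega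
          | (refine ⟨Pi.single 0 1, fun x => ?_⟩; simp [quad]; done)
          | (refine ⟨Pi.single 1 1, fun x => ?_⟩; simp [quad]; done)
          | (refine ⟨Pi.single 2 1, fun x => ?_⟩; simp [quad]; done)
          | (refine ⟨Pi.single 3 1, fun x => ?_⟩; simp [quad]; done)
          | (refine ⟨Pi.single 4 1, fun x => ?_⟩; simp [quad]; done)
          | (refine ⟨Pi.single 5 1, fun x => ?_⟩; simp [quad])
      refine ⟨p.coeff d • b + c, fun x => ?_⟩
      rw [Finset.sum_insert hd, hc x, hb x, quad_add, quad_smul]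
  obtain ⟨c, hc⟩ := key p.support fun d hd => by
    have := (MvPolynomial.le_totalDegree hd).trans hp
    rwa [Finsupp.sum_fintype _ _ (by simp), Fin.sum_univ_two] at this
  refine ⟨c, fun x => ?_⟩
  rw [← hc x, MvPolynomial.eval_eq']
  simp [Fin.prod_univ_two]

/-! ### Derivatives of piecewise quadratics on a closed triangle. -/

/-- A non-degenerate triangle has interior points. -/
theorem interior_cell_nonempty {K : Finset Plane} (hK : AffineIndependent ℝ ((↑) : K → Plane))
    (hK3 : K.card = 3) : (interior (cell K)).Nonempty := by
  rw [cell, interior_convexHull_nonempty_iff_affineSpan_eq_top]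
  have := (hK.affineSpan_eq_top_iff_card_eq_finrank_add_one (k := ℝ)).2 (by simp [hK3])
  simpa using this

theorem convex_cell (K : Finset Plane) : Convex ℝ (cell K) := convex_convexHull _ _

theorem isCompact_cell (K : Finset Plane) : IsCompact (cell K) :=
  K.finite_toSet.isCompact_convexHull (𝕜 := ℝ)

theorem measurableSet_cell (K : Finset Plane) : MeasurableSet (cell K) :=
  (isCompact_cell K).measurableSet

theorem uniqueDiffOn_cell {K : Finset Plane} (hK : AffineIndependent ℝ ((↑) : K → Plane))
    (hK3 : K.card = 3) : UniqueDiffOn ℝ (cell K) :=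
  uniqueDiffOn_convex (convex_cell K) (interior_cell_nonempty hK hK3)

section local_polynomial

variable {K : Finset Plane} {v : Plane → ℝ} {c : Fin 6 → ℝ}

/-- A convex set with interior points has unique derivatives up to its boundary. This matters
because jumps and averages evaluate the one-sided derivatives on the edges. -/
theorem grad_eq_gradQ (hK : AffineIndependent ℝ ((↑) : K → Plane)) (hK3 : K.card = 3)
    (hv : Set.EqOn v (quad c) (cell K)) : Set.EqOn (grad K v) (gradQ c) (cell K) := by
  intro x hx
  have h := (hasGradientAt_iff_hasFDerivAt.1 (hasGradientAt_quad c x)).hasFDerivWithinAt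
    (s := cell K)
  have h2 := (h.congr hv (hv hx)).fderivWithin (uniqueDiffOn_cell hK hK3 x hx)
  rw [grad, gradientWithin, h2]
  simp

theorem hess_eq_hessQ (hK : AffineIndependent ℝ ((↑) : K → Plane)) (hK3 : K.card = 3)
    (hv : Set.EqOn v (quad c) (cell K)) {x : Plane} (hx : x ∈ cell K) : hess K v x = hessQ c := by
  have h := ((hasFDerivAt_gradQ c x).hasFDerivWithinAt (s := cell K)).congr
    (grad_eq_gradQ hK hK3 hv) (grad_eq_gradQ hK hK3 hv hx)
  exact h.fderivWithin (uniqueDiffOn_cell hK hK3 x hx)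

/-- The unrestricted gradient is determined by the triangle only at interior points; that is enough
for integrals over Ω. -/
theorem gradient_eq_gradQ (hv : Set.EqOn v (quad c) (cell K)) {x : Plane}
    (hx : x ∈ interior (cell K)) : gradient v x = gradQ c x := by
  have h : v =ᶠ[nhds x] quad c := by
    filter_upwards [isOpen_interior.mem_nhds hx] with y hy using hv (interior_subset hy)
  exact ((hasGradientAt_quad c x).congr_of_eventuallyEq h).gradient

end local_polynomial

/-! ### Integrals over triangles and edges in affine coordinates. -/

/-- The determinant of two vectors of the plane. -/
def cross (u v : Plane) : ℝ := u 0 * v 1 - u 1 * v 0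

/-- The affine map which sends the unit triangle to the triangle with vertices `a, b, c`. -/
def param (a b c : Plane) (s t : ℝ) : Plane := a + (s • (b - a) + t • (c - a))

/-- The unit triangle. -/
def unitTriangle : Set (ℝ × ℝ) := {p | 0 ≤ p.1 ∧ 0 ≤ p.2 ∧ p.1 + p.2 ≤ 1}

theorem isClosed_unitTriangle : IsClosed unitTriangle :=
  (isClosed_le continuous_const continuous_fst).inter
    ((isClosed_le continuous_const continuous_snd).inter
      (isClosed_le (continuous_fst.add continuous_snd) continuous_const))

theorem isCompact_unitTriangle : IsCompact unitTriangle := by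
  refine (isCompact_Icc (a := ((0 : ℝ), (0 : ℝ))) (b := (1, 1))).of_isClosed_subset
    isClosed_unitTriangle ?_
  rintro ⟨s, t⟩ ⟨h1, h2, h3⟩
  simp only at h1 h2 h3
  exact ⟨⟨h1, h2⟩, ⟨by dsimp only; linarith, by dsimp only; linarith⟩⟩

theorem continuous_param (a b c : Plane) : Continuous fun p : ℝ × ℝ => param a b c p.1 p.2 := by
  unfold param
  fun_prop

theorem cell_eq_image (a b c : Plane) :
    cell {a, b, c} = (fun p : ℝ × ℝ => param a b c p.1 p.2) '' unitTriangle := by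
  apply Set.Subset.antisymm
  · apply convexHull_min
    · intro x hx
      simp only [Finset.coe_insert, Finset.coe_singleton, Set.mem_insert_iff,
        Set.mem_singleton_iff] at hx
      rcases hx with rfl | rfl | rfl
      · exact ⟨(0, 0), by simp [unitTriangle], by simp [param]⟩
      · exact ⟨(1, 0), by simp [unitTriangle], by simp [param]⟩
      · exact ⟨(0, 1), by simp [unitTriangle], by simp [param]⟩
    · rintro _ ⟨p, ⟨hp1, hp2, hp3⟩, rfl⟩ _ ⟨q, ⟨hq1, hq2, hq3⟩, rfl⟩ r t hr ht hrt
      refine ⟨(r * p.1 + t * q.1, r * p.2 + t * q.2), ⟨by positivity, by positivity, ?_⟩, ?_⟩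
      · dsimp only
        nlinarith
      · have : t = 1 - r := by linarith
        subst this
        simp only [param]
        module
  · rintro _ ⟨p, ⟨hp1, hp2, hp3⟩, rfl⟩
    have ha : a ∈ cell {a, b, c} := subset_convexHull ℝ _ (by simp)
    have hb : b ∈ cell {a, b, c} := subset_convexHull ℝ _ (by simp)
    have hc : c ∈ cell {a, b, c} := subset_convexHull ℝ _ (by simp)
    have := (convex_cell {a, b, c}).sum_mem (t := Finset.univ)
      (w := ![1 - p.1 - p.2, p.1, p.2]) (z := ![a, b, c])
      (by intro i _; fin_cases i <;> simp <;> linarith)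
      (by simp only [Fin.sum_univ_three, Matrix.cons_val]; ring)
      (by intro i _; fin_cases i <;> simpa)
    convert this using 1
    simp only [param, Fin.sum_univ_three, Matrix.cons_val]
    module

/-- The linear map with the given columns. -/
def columns (u v : Plane) : Plane →ₗ[ℝ] Plane where
  toFun x := x 0 • u + x 1 • v
  map_add' x y := by simp only [PiLp.add_apply]; module
  map_smul' r x := by simp only [PiLp.smul_apply, smul_eq_mul, RingHom.id_apply]; module

theorem det_columns (u v : Plane) : LinearMap.det (columns u v) = cross u v := by
  rw [← LinearMap.det_toMatrix (EuclideanSpace.basisFun (Fin 2) ℝ).toBasis, Matrix.det_fin_two]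
  simp [LinearMap.toMatrix_apply, columns, cross]
  ring

/-- The measurable equivalence between the plane and `ℝ × ℝ`. -/
def planeEquiv : Plane ≃ᵐ ℝ × ℝ :=
  (MeasurableEquiv.toLp 2 (Fin 2 → ℝ)).symm.trans MeasurableEquiv.finTwoArrow

theorem measurePreserving_planeEquiv : MeasurePreserving planeEquiv :=
  (EuclideanSpace.volume_preserving_symm_measurableEquiv_toLp (Fin 2)).trans
    (volume_preserving_finTwoArrow ℝ)

theorem param_eq (a b c x : Plane) :
    param a b c (planeEquiv x).1 (planeEquiv x).2 = a + columns (b - a) (c - a) x := rfl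

theorem cell_eq_image_plane (a b c : Plane) :
    cell {a, b, c} = (fun x => a + columns (b - a) (c - a) x) '' (planeEquiv ⁻¹' unitTriangle) := by
  rw [cell_eq_image]
  ext x
  constructor
  · rintro ⟨p, hp, rfl⟩
    refine ⟨planeEquiv.symm p, by simpa using hp, ?_⟩
    dsimp only
    rw [← param_eq, planeEquiv.apply_symm_apply]
  · rintro ⟨y, hy, rfl⟩
    exact ⟨planeEquiv y, hy, rfl⟩

theorem cross_ne_zero {a b c : Plane} (h : (interior (cell {a, b, c})).Nonempty) :
    cross (b - a) (c - a) ≠ 0 := by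
  intro h0
  have h1 : volume (cell {a, b, c}) = 0 := by
    rw [cell_eq_image_plane, ← Set.image_image (fun y => a + y), Set.image_add_left,
      measure_preimage_add, Measure.addHaar_image_linearMap, det_columns, h0]
    simp
  have h2 : 0 < volume (cell {a, b, c}) :=
    (isOpen_interior.measure_pos volume h).trans_le (measure_mono interior_subset)
  exact h2.ne' h1

theorem setIntegral_cell {a b c : Plane} (h : (interior (cell {a, b, c})).Nonempty)
    (f : Plane → ℝ) :
    ∫ x in cell {a, b, c}, f x
      = |cross (b - a) (c - a)| * ∫ p in unitTriangle, f (param a b c p.1 p.2) := by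
  have hdet := cross_ne_zero h
  have hm : MeasurableSet (planeEquiv ⁻¹' unitTriangle) :=
    planeEquiv.measurable isClosed_unitTriangle.measurableSet
  set A := LinearMap.toContinuousLinearMap (columns (b - a) (c - a)) with hA
  have hAdet : A.det = cross (b - a) (c - a) := by
    rw [ContinuousLinearMap.det, ← det_columns]
    rfl
  have hinj : Function.Injective (columns (b - a) (c - a)) := by
    have : IsUnit (LinearMap.det (columns (b - a) (c - a))) := by
      rw [det_columns]; exact hdet.isUnit
    exact ((Module.End.isUnit_iff _).1 ((LinearMap.isUnit_iff_isUnit_det _).2 this)).1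
  rw [cell_eq_image_plane, integral_image_eq_integral_abs_det_fderiv_smul volume hm
    (f := fun x => a + columns (b - a) (c - a) x) (f' := fun _ => A)
    (fun x _ => (A.hasFDerivAt.const_add a).hasFDerivWithinAt)
    (fun x _ y _ hxy => hinj (add_left_cancel hxy)), hAdet,
    ← measurePreserving_planeEquiv.setIntegral_preimage_emb planeEquiv.measurableEmbedding,
    ← integral_const_mul]
  rfl

theorem setIntegral_unitTriangle {F : ℝ → ℝ → ℝ} (hF : Continuous fun p : ℝ × ℝ => F p.1 p.2) :
    ∫ p in unitTriangle, F p.1 p.2 = ∫ t in (0 : ℝ)..1, ∫ s in (0 : ℝ)..(1 - t), F s t := by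
  have hint : IntegrableOn (fun p : ℝ × ℝ => F p.1 p.2) unitTriangle :=
    hF.continuousOn.integrableOn_compact isCompact_unitTriangle
  have hmeas := isClosed_unitTriangle.measurableSet
  rw [← integral_indicator hmeas, Measure.volume_eq_prod, integral_prod_symm]
  swap
  · rw [← Measure.volume_eq_prod]
    exact hint.integrable_indicator hmeas
  rw [intervalIntegral.integral_of_le zero_le_one, ← integral_Icc_eq_integral_Ioc,
    ← integral_indicator measurableSet_Icc]
  congr 1
  funext t
  by_cases ht : t ∈ Set.Icc (0 : ℝ) 1
  · rw [Set.indicator_of_mem ht, intervalIntegral.integral_of_le (by linarith [ht.2]),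
      ← integral_Icc_eq_integral_Ioc, ← integral_indicator measurableSet_Icc]
    congr 1
    funext s
    by_cases hs : s ∈ Set.Icc (0 : ℝ) (1 - t)
    · rw [Set.indicator_of_mem hs, Set.indicator_of_mem]
      exact ⟨hs.1, ht.1, by dsimp only; linarith [hs.2]⟩
    · rw [Set.indicator_of_notMem hs, Set.indicator_of_notMem]
      rintro ⟨h1, h2, h3⟩
      exact hs ⟨h1, by dsimp only at h3; linarith⟩
  · rw [Set.indicator_of_notMem ht]
    have : (fun s => unitTriangle.indicator (fun p : ℝ × ℝ => F p.1 p.2) (s, t)) = fun _ => 0 := by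
      funext s
      rw [Set.indicator_of_notMem]
      rintro ⟨h1, h2, h3⟩
      dsimp only at h1 h2 h3
      exact ht ⟨h2, by linarith⟩
    rw [this, integral_zero]

theorem setIntegral_cell_eq_iterated {a b c : Plane} (h : (interior (cell {a, b, c})).Nonempty)
    {f : Plane → ℝ} (hf : Continuous f) :
    ∫ x in cell {a, b, c}, f x = |cross (b - a) (c - a)| *
      ∫ t in (0 : ℝ)..1, ∫ s in (0 : ℝ)..(1 - t), f (param a b c s t) := by
  rw [setIntegral_cell h, setIntegral_unitTriangle (F := fun s t => f (param a b c s t))]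
  exact hf.comp (continuous_param a b c)

theorem cell_pair (b c : Plane) : cell {b, c} = segment ℝ b c := by
  simp [cell, convexHull_pair]

theorem edgeIntegral_pair {b c : Plane} (f : Plane → ℝ) :
    Triangulation.edgeIntegral {b, c} f
      = dist b c * ∫ t in (0 : ℝ)..1, f (AffineMap.lineMap b c t) := by
  rw [Triangulation.edgeIntegral, cell_pair]
  by_cases hbc : b = c
  · subst hbc
    rw [segment_same, dist_self, zero_mul]
    apply setIntegral_measure_zero
    have := hausdorffMeasure_segment b b
    rwa [segment_same, edist_self] at this
  have hemb : MeasurableEmbedding (AffineMap.lineMap b c : ℝ → Plane) := by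
    have hinj : Function.Injective (AffineMap.lineMap b c : ℝ → Plane) :=
      AffineMap.lineMap_injective ℝ hbc
    exact (AffineMap.lineMap_continuous (p := b) (q := c)).measurableEmbedding hinj
  have key : (Measure.hausdorffMeasure 1 : Measure Plane).restrict (segment ℝ b c)
      = nndist b c • (volume.restrict (Set.Icc (0 : ℝ) 1)).map (AffineMap.lineMap b c) := by
    ext s hs
    rw [Measure.restrict_apply hs, Measure.smul_apply, hemb.map_apply,
      Measure.restrict_apply (hemb.measurable hs), segment_eq_image_lineMap,
      ← Set.image_preimage_inter, hausdorffMeasure_lineMap_image, hausdorffMeasure_real]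
  rw [key, integral_smul_nnreal_measure, hemb.integral_map,
    intervalIntegral.integral_of_le zero_le_one, ← integral_Icc_eq_integral_Ioc, NNReal.smul_def,
    coe_nndist, smul_eq_mul]

/-! ### The divergence theorem on a triangle. -/

theorem param_one_sub (a b c : Plane) (t : ℝ) :
    param a b c (1 - t) t = AffineMap.lineMap b c t := by
  simp only [param, AffineMap.lineMap_apply_module]
  module

theorem param_zero (a b c : Plane) (t : ℝ) : param a b c 0 t = AffineMap.lineMap a c t := by
  simp only [param, AffineMap.lineMap_apply_module]
  module

/-- In the coordinates (s, t) of `param`, b - a is the s direction, so the fundamental theorem of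
calculus on each slice of constant t leaves the values on the edges bc (s = 1 - t) and ac (s = 0).
-/
theorem integral_fderiv_cell {a b c : Plane} (h : (interior (cell {a, b, c})).Nonempty)
    {f : Plane → ℝ} (hf : ContDiff ℝ 1 f) :
    ∫ x in cell {a, b, c}, fderiv ℝ f x (b - a) = |cross (b - a) (c - a)| *
      ((∫ t in (0 : ℝ)..1, f (AffineMap.lineMap b c t))
        - ∫ t in (0 : ℝ)..1, f (AffineMap.lineMap a c t)) := by
  have hf' : Continuous (fderiv ℝ f) := hf.continuous_fderiv one_ne_zero
  have hcont : Continuous fun x => fderiv ℝ f x (b - a) := hf'.clm_apply continuous_const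
  have hline : ∀ p q : Plane, Continuous fun t : ℝ => f (AffineMap.lineMap p q t) := fun p q =>
    hf.continuous.comp AffineMap.lineMap_continuous
  rw [setIntegral_cell_eq_iterated h hcont, ← intervalIntegral.integral_sub
    ((hline b c).intervalIntegrable _ _) ((hline a c).intervalIntegrable _ _)]
  congr 1
  apply intervalIntegral.integral_congr
  intro t _
  dsimp only
  rw [← param_one_sub a b c, ← param_zero a b c]
  apply intervalIntegral.integral_eq_sub_of_hasDerivAt
    (f := fun s => f (param a b c s t))
  · intro s _
    have h1 : HasDerivAt (fun s => param a b c s t) (b - a) s := by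
      have := (((hasDerivAt_id s).smul_const (b - a)).add_const (t • (c - a))).const_add a
      simpa [param] using this
    exact ((hf.differentiable one_ne_zero _).hasFDerivAt).comp_hasDerivAt s h1
  · apply Continuous.intervalIntegrable
    exact hcont.comp ((continuous_param a b c).comp (Continuous.prodMk_left t))

section triangle

variable {K : Finset Plane} {a b c : Plane}

theorem card_pair_of_triangle (hK3 : K.card = 3) (hK : K = {a, b, c}) :
    a ≠ b ∧ a ≠ c ∧ b ≠ c := by
  subst hK
  refine ⟨?_, ?_, ?_⟩ <;> rintro rfl
  · have := (Finset.card_le_two (a := a) (b := c))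
    simp at hK3
    omega
  · have := (Finset.card_le_two (a := a) (b := b))
    have h : ({a, b, a} : Finset Plane) = {a, b} := by ext; simp; tauto
    rw [h] at hK3
    omega
  · have := (Finset.card_le_two (a := a) (b := b))
    simp at hK3
    omega

/-- Height over bc times length of bc: both sides are twice the area. This converts the Jacobian of
`param` into the weight of the normal in the divergence theorem. -/
theorem inner_outwardNormal_mul_dist (hind : AffineIndependent ℝ ((↑) : K → Plane))
    (hK3 : K.card = 3) (hK : K = {a, b, c}) :
    ⟪b - a, outwardNormal K {b, c}⟫ * dist b c = |cross (b - a) (c - a)|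
      ∧ ⟪c - b, outwardNormal K {b, c}⟫ = 0 := by
  obtain ⟨hab, hac, hbc⟩ := card_pair_of_triangle hK3 hK
  obtain ⟨hn1, hn2⟩ := isOutwardNormal_outwardNormal (e := {b, c}) hind hK3
    (by subst hK; intro x; simp; tauto) (Finset.card_pair hbc)
  set n := outwardNormal K {b, c}
  have h1 := hn2 c (by simp [hK]) b (by simp)
  have h2 := hn2 b (by simp [hK]) c (by simp)
  have h3 := hn2 a (by simp [hK]) b (by simp)
  have hnn : n 0 * n 0 + n 1 * n 1 = 1 := by
    rw [← inner_plane, real_inner_self_eq_norm_sq, hn1, one_pow]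
  have hd : dist b c ^ 2 = (c 0 - b 0) ^ 2 + (c 1 - b 1) ^ 2 := by
    rw [dist_comm, dist_eq_norm, ← real_inner_self_eq_norm_sq, inner_plane]
    simp
    ring
  rw [inner_plane] at h1 h2 h3 ⊢
  rw [inner_plane]
  simp only [PiLp.sub_apply, cross] at h1 h2 h3 ⊢
  have h0 : n 0 * (c 0 - b 0) + n 1 * (c 1 - b 1) = 0 := by linarith
  refine ⟨?_, by linarith⟩
  rw [← abs_of_nonneg (a := ((b 0 - a 0) * n 0 + (b 1 - a 1) * n 1) * dist b c)
    (mul_nonneg (by linarith) dist_nonneg), ← sq_eq_sq_iff_abs_eq_abs, mul_pow, hd]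
  -- As c - b is orthogonal to the unit vector n, it is l times n rotated by a right angle, and l is
  -- the signed length of the edge.
  set l := n 0 * (c 1 - b 1) - n 1 * (c 0 - b 0) with hl
  have hw0 : c 0 = b 0 - l * n 1 := by rw [hl]; linear_combination (b 0 - c 0) * hnn + n 0 * h0
  have hw1 : c 1 = b 1 + l * n 0 := by rw [hl]; linear_combination (b 1 - c 1) * hnn + n 1 * h0
  rw [hw0, hw1]
  linear_combination ((b 0 - a 0) * n 0 + (b 1 - a 1) * n 1) ^ 2 * l ^ 2 * hnn

/-- The edge ab contributes nothing because b - a is tangent to it; the other two terms are those of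
`integral_fderiv_cell`. -/
theorem directional_divergence (hind : AffineIndependent ℝ ((↑) : K → Plane))
    (hK3 : K.card = 3) (hK : K = {a, b, c}) {f : Plane → ℝ} (hf : ContDiff ℝ 1 f) :
    ∫ x in cell K, fderiv ℝ f x (b - a) =
      ⟪b - a, outwardNormal K {b, c}⟫ * Triangulation.edgeIntegral {b, c} f
      + ⟪b - a, outwardNormal K {a, c}⟫ * Triangulation.edgeIntegral {a, c} f
      + ⟪b - a, outwardNormal K {a, b}⟫ * Triangulation.edgeIntegral {a, b} f := by
  have h1 := (inner_outwardNormal_mul_dist hind hK3 hK).1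
  have h2 := (inner_outwardNormal_mul_dist (a := b) (b := a) (c := c) hind hK3
    (by rw [hK, Finset.insert_comm])).1
  have h3 := (inner_outwardNormal_mul_dist (a := c) (b := a) (c := b) hind hK3
    (by rw [hK]; ext; simp; tauto)).2
  have hcross : |cross (a - b) (c - b)| = |cross (b - a) (c - a)| := by
    rw [← abs_neg]
    congr 1
    simp [cross]
    ring
  have hne := interior_cell_nonempty hind hK3
  rw [h3, edgeIntegral_pair, edgeIntegral_pair, zero_mul, add_zero, ← mul_assoc, ← mul_assoc, h1,
    ← neg_sub a b, inner_neg_left, neg_mul, h2, hcross]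
  subst hK
  rw [neg_sub, integral_fderiv_cell hne hf]
  ring

theorem exists_smul_add_smul (h : cross (b - a) (c - a) ≠ 0) (d : Plane) :
    ∃ s t : ℝ, d = s • (b - a) + t • (c - a) := by
  refine ⟨cross d (c - a) / cross (b - a) (c - a), cross (b - a) d / cross (b - a) (c - a), ?_⟩
  ext i
  simp only [PiLp.add_apply, PiLp.smul_apply, smul_eq_mul]
  rw [div_mul_eq_mul_div, div_mul_eq_mul_div, ← add_div, eq_div_iff h]
  fin_cases i <;> simp [cross] <;> ring

theorem sum_powersetCard_two {g : Finset Plane → ℝ} (hK3 : K.card = 3) (hK : K = {a, b, c}) :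
    ∑ e ∈ K.powersetCard 2, g e = g {b, c} + g {a, c} + g {a, b} := by
  obtain ⟨hab, hac, hbc⟩ := card_pair_of_triangle hK3 hK
  have : K.powersetCard 2 = {{b, c}, {a, c}, {a, b}} := by
    subst hK
    ext e
    simp only [Finset.mem_powersetCard, Finset.mem_insert, Finset.mem_singleton]
    constructor
    · rintro ⟨h1, h2⟩
      obtain ⟨x, y, hxy, rfl⟩ := Finset.card_eq_two.1 h2
      have hx := h1 (Finset.mem_insert_self x _)
      have hy := h1 (Finset.mem_insert_of_mem (Finset.mem_singleton_self y))
      simp only [Finset.mem_insert, Finset.mem_singleton] at hx hy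
      rcases hx with rfl | rfl | rfl <;> rcases hy with rfl | rfl | rfl <;>
        simp_all [Finset.pair_comm]
    · rintro (rfl | rfl | rfl)
      · exact ⟨by intro x; simp; tauto, Finset.card_pair hbc⟩
      · exact ⟨by intro x; simp; tauto, Finset.card_pair hac⟩
      · exact ⟨by intro x; simp; tauto, Finset.card_pair hab⟩
  have h1 : ({b, c} : Finset Plane) ∉ ({{a, c}, {a, b}} : Finset (Finset Plane)) := by
    simp only [Finset.mem_insert, Finset.mem_singleton, not_or]
    refine ⟨fun h => ?_, fun h => ?_⟩
    · have : a ∈ ({b, c} : Finset Plane) := by rw [h]; simp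
      simp_all
    · have : a ∈ ({b, c} : Finset Plane) := by rw [h]; simp
      simp_all
  have h2 : ({a, c} : Finset Plane) ∉ ({{a, b}} : Finset (Finset Plane)) := by
    simp only [Finset.mem_singleton]
    intro h
    have : b ∈ ({a, c} : Finset Plane) := by rw [h]; simp
    simp_all [eq_comm]
  rw [this, Finset.sum_insert h1, Finset.sum_insert h2, Finset.sum_singleton, add_assoc]

end triangle

/-- The divergence theorem on a triangle, for the vector field `f d` with a constant vector `d`. -/
theorem integral_fderiv_eq_sum_edgeIntegral {K : Finset Plane}
    (hind : AffineIndependent ℝ ((↑) : K → Plane)) (hK3 : K.card = 3) {f : Plane → ℝ}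
    (hf : ContDiff ℝ 1 f) (d : Plane) :
    ∫ x in cell K, fderiv ℝ f x d
      = ∑ e ∈ K.powersetCard 2, ⟪d, outwardNormal K e⟫ * Triangulation.edgeIntegral e f := by
  obtain ⟨a, b, c, -, -, -, hK⟩ := Finset.card_eq_three.1 hK3
  have hK' : K = {a, c, b} := by rw [hK]; ext; simp; tauto
  have hcross : cross (b - a) (c - a) ≠ 0 := by
    apply cross_ne_zero
    rw [← hK]
    exact interior_cell_nonempty hind hK3
  obtain ⟨s, t, rfl⟩ := exists_smul_add_smul hcross d
  -- Both sides are linear in the direction, so the edge directions b - a and c - a suffice; the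
  -- second is the first with b and c exchanged.
  have hf' : Continuous (fderiv ℝ f) := hf.continuous_fderiv one_ne_zero
  have hint : ∀ w : Plane, IntegrableOn (fun x => fderiv ℝ f x w) (cell K) := fun w =>
    (hf'.clm_apply continuous_const).continuousOn.integrableOn_compact (isCompact_cell K)
  simp only [map_add, map_smul, smul_eq_mul, inner_add_left, real_inner_smul_left]
  rw [integral_add ((hint _).const_mul s) ((hint _).const_mul t), integral_const_mul,
    integral_const_mul, directional_divergence hind hK3 hK hf,
    directional_divergence hind hK3 hK' hf, sum_powersetCard_two hK3 hK, Finset.pair_comm c b]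
  ring

/-! ### Inverse trace inequalities for quadratics. -/

/-- An inverse trace inequality on an interval, for quadratic polynomials. -/
theorem mul_sq_le_nine_integral {α β γ l : ℝ} (hl : 0 ≤ l) :
    l * (α + β * l + γ * l ^ 2) ^ 2 ≤ 9 * ∫ s in (0 : ℝ)..l, (α + β * s + γ * s ^ 2) ^ 2 := by
  have h : ∫ s in (0 : ℝ)..l, (α + β * s + γ * s ^ 2) ^ 2
      = α ^ 2 * l + α * β * l ^ 2 + (β ^ 2 + 2 * α * γ) * l ^ 3 / 3 + β * γ * l ^ 4 / 2
        + γ ^ 2 * l ^ 5 / 5 := by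
    rw [intervalIntegral.integral_eq_sub_of_hasDerivAt
      (f := fun s => α ^ 2 * s + α * β * s ^ 2 + (β ^ 2 + 2 * α * γ) * s ^ 3 / 3
        + β * γ * s ^ 4 / 2 + γ ^ 2 * s ^ 5 / 5)]
    · ring
    · intro s _
      have := (((((hasDerivAt_id' s).const_mul (α ^ 2)).add
        ((hasDerivAt_pow 2 s).const_mul (α * β))).add
        (((hasDerivAt_pow 3 s).const_mul (β ^ 2 + 2 * α * γ)).div_const 3)).add
        (((hasDerivAt_pow 4 s).const_mul (β * γ)).div_const 2)).add
        (((hasDerivAt_pow 5 s).const_mul (γ ^ 2)).div_const 5)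
      refine this.congr_deriv ?_
      norm_num
      ring
    · apply Continuous.intervalIntegrable
      fun_prop
  rw [h]
  -- The difference of the two sides is an explicit sum of squares; 9 = (2 + 1)² is the sharp
  -- constant in degree 2.
  have h1 : 9 * (α ^ 2 * l + α * β * l ^ 2 + (β ^ 2 + 2 * α * γ) * l ^ 3 / 3 + β * γ * l ^ 4 / 2
        + γ ^ 2 * l ^ 5 / 5) - l * (α + β * l + γ * l ^ 2) ^ 2
      = l * (8 * (α + 7 * (β * l) / 16 + γ * l ^ 2 / 4) ^ 2
        + 15 / 32 * (β * l + 4 / 5 * (γ * l ^ 2)) ^ 2) := by ring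
  have h2 : 0 ≤ l * (8 * (α + 7 * (β * l) / 16 + γ * l ^ 2 / 4) ^ 2
        + 15 / 32 * (β * l + 4 / 5 * (γ * l ^ 2)) ^ 2) := by positivity
  linarith

theorem quad_add_smul (q : Fin 6 → ℝ) (p d : Plane) (s : ℝ) :
    quad q (p + s • d) = quad q p + ⟪gradQ q p, d⟫ * s
      + (q 3 * d 0 ^ 2 + q 4 * (d 0 * d 1) + q 5 * d 1 ^ 2) * s ^ 2 := by
  simp [quad, inner_plane]
  ring

/-- The one-dimensional inequality on each slice parallel to ab, whose end on bc is at s = 1 - t.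
The weight 1 - t is the parameter length of the slice and vanishes at c. -/
theorem weighted_trace_le (q : Fin 6 → ℝ) {a b c : Plane}
    (h : (interior (cell {a, b, c})).Nonempty) :
    |cross (b - a) (c - a)| * ∫ t in (0 : ℝ)..1, (1 - t) * quad q (AffineMap.lineMap b c t) ^ 2
      ≤ 9 * ∫ x in cell {a, b, c}, quad q x ^ 2 := by
  have hq := continuous_quad q
  rw [setIntegral_cell_eq_iterated h (f := fun x => quad q x ^ 2) (hq.pow 2), mul_left_comm]
  apply mul_le_mul_of_nonneg_left _ (abs_nonneg _)
  rw [← intervalIntegral.integral_const_mul]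
  apply intervalIntegral.integral_mono_on zero_le_one
  · apply Continuous.intervalIntegrable
    exact (continuous_const.sub continuous_id).mul
      ((hq.comp AffineMap.lineMap_continuous).pow 2)
  · apply Continuous.intervalIntegrable
    apply continuous_const.mul
    apply intervalIntegral.continuous_parametric_intervalIntegral_of_continuous
    · exact (hq.comp ((continuous_param a b c).comp continuous_swap)).pow 2
    · fun_prop
  · intro t ht
    have hp : ∀ s, param a b c s t = (a + t • (c - a)) + s • (b - a) := fun s => by
      simp only [param]; module
    rw [← param_one_sub a b c, hp]
    simp only [hp, quad_add_smul]
    exact mul_sq_le_nine_integral (by linarith [ht.2])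

/-- The inverse trace inequality on a triangle, for quadratic polynomials. -/
theorem trace_le (q : Fin 6 → ℝ) {a b c : Plane} (h : (interior (cell {a, b, c})).Nonempty) :
    |cross (b - a) (c - a)| * ∫ t in (0 : ℝ)..1, quad q (AffineMap.lineMap b c t) ^ 2
      ≤ 18 * ∫ x in cell {a, b, c}, quad q x ^ 2 := by
  have hset : ({a, c, b} : Finset Plane) = {a, b, c} := by ext; simp; tauto
  -- Slicing parallel to ab and to ac gives the weights 1 - t and t, which add up to 1; hence 18 = 9
  -- + 9.
  have h1 := weighted_trace_le q h
  have h2 := weighted_trace_le q (a := a) (b := c) (c := b) (by rwa [hset])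
  have hcross : |cross (c - a) (b - a)| = |cross (b - a) (c - a)| := by
    rw [← abs_neg]
    congr 1
    simp [cross]
    ring
  have hswap : ∫ t in (0 : ℝ)..1, (1 - t) * quad q (AffineMap.lineMap c b t) ^ 2
      = ∫ t in (0 : ℝ)..1, t * quad q (AffineMap.lineMap b c t) ^ 2 := by
    have := intervalIntegral.integral_comp_sub_left (a := 0) (b := 1)
      (fun t => t * quad q (AffineMap.lineMap b c t) ^ 2) (1 : ℝ)
    simpa [AffineMap.lineMap_apply_one_sub] using this
  rw [hset, hcross, hswap] at h2
  have hc : Continuous fun t : ℝ => quad q (AffineMap.lineMap b c t) ^ 2 :=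
    ((continuous_quad q).comp AffineMap.lineMap_continuous).pow 2
  have hsum : ∫ t in (0 : ℝ)..1, quad q (AffineMap.lineMap b c t) ^ 2
      = (∫ t in (0 : ℝ)..1, (1 - t) * quad q (AffineMap.lineMap b c t) ^ 2)
        + ∫ t in (0 : ℝ)..1, t * quad q (AffineMap.lineMap b c t) ^ 2 := by
    rw [← intervalIntegral.integral_add]
    · congr 1
      funext t
      ring
    · exact ((continuous_const.sub continuous_id).mul hc).intervalIntegrable _ _
    · exact (continuous_id.mul hc).intervalIntegrable _ _
  rw [hsum]
  linarith

/-! ### Areas, diameters and null sets. -/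

theorem volume_real_cell {a b c : Plane} (h : (interior (cell {a, b, c})).Nonempty) :
    volume.real (cell {a, b, c}) = |cross (b - a) (c - a)| / 2 := by
  have h1 := setIntegral_cell_eq_iterated h (f := fun _ => 1) continuous_const
  simp only [setIntegral_const, smul_eq_mul, mul_one, intervalIntegral.integral_const,
    sub_zero] at h1
  rw [h1, intervalIntegral.integral_sub (by simp) (by simp), integral_id]
  simp
  ring

theorem diam_pair (b c : Plane) : Triangulation.diam {b, c} = dist b c := by
  rw [Triangulation.diam, cell, convexHull_diam]
  simp [Metric.diam_pair]

theorem diam_mono {e K : Finset Plane} (h : e ⊆ K) :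
    Triangulation.diam e ≤ Triangulation.diam K :=
  Metric.diam_mono (convexHull_mono (by exact_mod_cast h)) (isCompact_cell K).isBounded

theorem cell_mono {e K : Finset Plane} (h : e ⊆ K) : cell e ⊆ cell K :=
  convexHull_mono (by exact_mod_cast h)

/-- Compare the area of the triangle with that of the inscribed ball, π h²/σ². This is the only way
in which shape regularity enters the estimates. -/
theorem diam_sq_le_volume {σ : ℝ} (hσ : 0 < σ) {K : Finset Plane} {x : Plane}
    (h : Metric.closedBall x (Triangulation.diam K / σ) ⊆ cell K) :
    Triangulation.diam K ^ 2 ≤ σ ^ 2 / Real.pi * volume.real (cell K) := by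
  have hd : 0 ≤ Triangulation.diam K := Metric.diam_nonneg
  have h1 : volume.real (Metric.closedBall x (Triangulation.diam K / σ))
      ≤ volume.real (cell K) := measureReal_mono h (isCompact_cell K).measure_lt_top.ne
  rw [measureReal_def, EuclideanSpace.volume_closedBall_fin_two, ENNReal.toReal_mul,
    ENNReal.toReal_pow, ENNReal.toReal_ofReal (by positivity),
    ENNReal.toReal_ofReal Real.pi_pos.le] at h1
  have hpi := Real.pi_pos
  rw [div_mul_eq_mul_div, le_div_iff₀ hpi]
  rw [div_pow, div_mul_eq_mul_div, div_le_iff₀ (by positivity)] at h1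
  linarith

theorem volume_segment (a b : Plane) : volume (segment ℝ a b) = 0 := by
  refine measure_mono_null (t := (affineSpan ℝ {a, b} : Set Plane)) ?_
    (Measure.addHaar_affineSubspace volume _ ?_)
  · rw [← convexHull_pair]
    exact convexHull_subset_affineSpan _
  · intro h
    have h1 := collinear_iff_finrank_le_one.1 (collinear_pair ℝ a b)
    rw [← direction_affineSpan, h, AffineSubspace.direction_top, finrank_top] at h1
    simp at h1

theorem volume_cell_of_card_le_two {s : Finset Plane} (hs : s.card ≤ 2) :
    volume (cell s) = 0 := by
  have hs' : s.card = 0 ∨ s.card = 1 ∨ s.card = 2 := by omega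
  rcases hs' with h | h | h
  · rw [Finset.card_eq_zero.1 h]
    simp [cell]
  · obtain ⟨a, rfl⟩ := Finset.card_eq_one.1 h
    simp [cell]
  · obtain ⟨a, b, -, rfl⟩ := Finset.card_eq_two.1 h
    rw [cell_pair, volume_segment]

theorem IsPolygonalDomain.volume_frontier {Ω : Set Plane} (hΩ : IsPolygonalDomain Ω) :
    volume (frontier Ω) = 0 := by
  obtain ⟨S, hS⟩ := hΩ.frontier_eq
  rw [hS]
  exact (measure_biUnion_null_iff S.countable_toSet).2 fun p _ => volume_segment p.1 p.2

theorem ae_mem_interior_cell (K : Finset Plane) :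
    ∀ᵐ x ∂volume.restrict (cell K), x ∈ interior (cell K) := by
  rw [ae_restrict_iff' (measurableSet_cell K)]
  have h : volume (frontier (cell K)) = 0 := (convex_cell K).addHaar_frontier volume
  filter_upwards [measure_eq_zero_iff_ae_notMem.1 h] with x hx hxK
  by_contra hxi
  exact hx ⟨subset_closure hxK, hxi⟩

theorem integrableOn_cell (K : Finset Plane) {f : Plane → ℝ} (hf : Continuous f) :
    IntegrableOn f (cell K) :=
  hf.continuousOn.integrableOn_compact (isCompact_cell K)

theorem integrableOn_edge {e : Finset Plane} (he : e.card = 2) {f : Plane → ℝ}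
    (hf : Continuous f) : IntegrableOn f (cell e) (Measure.hausdorffMeasure 1) := by
  obtain ⟨b, c, -, rfl⟩ := Finset.card_eq_two.1 he
  apply hf.continuousOn.integrableOn_of_subset_isCompact (isCompact_cell _)
    (measurableSet_cell _) subset_rfl
  rw [cell_pair, hausdorffMeasure_segment]
  exact (edist_lt_top b c).ne

/-! ### Splitting integrals over Ω into integrals over the triangles. -/

namespace Triangulation

variable {Ω : Set Plane} (T : Triangulation Ω)

theorem mem_triangles {K : Finset Plane} : K ∈ T.triangles ↔ K ∈ T.faces ∧ K.card = 3 := by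
  simp [triangles]

theorem mem_edges {e : Finset Plane} : e ∈ T.edges ↔ e ∈ T.faces ∧ e.card = 2 := by
  simp [edges]

theorem mem_adjacent {e K : Finset Plane} : K ∈ T.adjacent e ↔ K ∈ T.triangles ∧ e ⊆ K := by
  simp [adjacent]

theorem affineIndependent {K : Finset Plane} (hK : K ∈ T.triangles) :
    AffineIndependent ℝ ((↑) : K → Plane) := T.indep (T.mem_triangles.1 hK).1

theorem card_triangle {K : Finset Plane} (hK : K ∈ T.triangles) : K.card = 3 :=
  (T.mem_triangles.1 hK).2

theorem adjacent_nonempty {e : Finset Plane} (he : e ∈ T.edges) : (T.adjacent e).Nonempty := by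
  obtain ⟨K, hK, heK, hK3⟩ := T.pure e (T.mem_edges.1 he).1
  exact ⟨K, T.mem_adjacent.2 ⟨T.mem_triangles.2 ⟨hK, hK3⟩, heK⟩⟩

/-- Double counting of the incident pairs (triangle, edge); it gathers the boundary terms of all
triangles edge by edge. -/
theorem sum_triangles_sum_edges (g : Finset Plane → Finset Plane → ℝ) :
    ∑ K ∈ T.triangles, ∑ e ∈ K.powersetCard 2, g K e
      = ∑ e ∈ T.edges, ∑ K ∈ T.adjacent e, g K e := by
  apply Finset.sum_comm'
  intro K e
  rw [Finset.mem_powersetCard, mem_adjacent, mem_edges]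
  constructor
  · rintro ⟨hK, heK, he⟩
    exact ⟨⟨hK, heK⟩, T.down_closed (T.mem_triangles.1 hK).1 heK (Finset.card_pos.1 (by omega)), he⟩
  · rintro ⟨⟨hK, heK⟩, -, he⟩
    exact ⟨hK, heK, he⟩

theorem closure_eq_iUnion : closure Ω = ⋃ K ∈ T.triangles, cell K := by
  ext x
  rw [← T.space_eq, Geometry.SimplicialComplex.mem_space_iff]
  simp only [Set.mem_iUnion, exists_prop]
  constructor
  · rintro ⟨s, hs, hx⟩
    obtain ⟨K, hK, hsK, hK3⟩ := T.pure s hs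
    exact ⟨K, T.mem_triangles.2 ⟨hK, hK3⟩, cell_mono hsK hx⟩
  · rintro ⟨K, hK, hx⟩
    exact ⟨K, (T.mem_triangles.1 hK).1, hx⟩

/-- Conformity places the intersection in the hull of the common vertices, of which two distinct
triangles share at most two. -/
theorem volume_inter {K L : Finset Plane} (hK : K ∈ T.triangles) (hL : L ∈ T.triangles)
    (hKL : K ≠ L) : volume (cell K ∩ cell L) = 0 := by
  have h := T.inter_subset_convexHull (T.mem_triangles.1 hK).1 (T.mem_triangles.1 hL).1
  rw [← Finset.coe_inter] at h
  refine measure_mono_null h (volume_cell_of_card_le_two ?_)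
  by_contra hc
  apply hKL
  have h1 := T.card_triangle hK
  have h2 := T.card_triangle hL
  have h3 : K ∩ L = K := Finset.eq_of_subset_of_card_le Finset.inter_subset_left (by omega)
  have h4 : K ∩ L = L := Finset.eq_of_subset_of_card_le Finset.inter_subset_right (by omega)
  exact h3.symm.trans h4

theorem restrict_eq_sum (hΩ : IsPolygonalDomain Ω) :
    (volume : Measure Plane).restrict Ω = ∑ K ∈ T.triangles, volume.restrict (cell K) := by
  classical
  -- The triangles cover the closure of Ω, which differs from Ω by a finite union of segments, a
  -- null set.
  have h1 : (volume : Measure Plane).restrict Ω = volume.restrict (closure Ω) := by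
    apply Measure.restrict_congr_set
    symm
    apply closure_ae_eq_of_null_frontier
    exact hΩ.volume_frontier
  rw [h1, T.closure_eq_iUnion]
  have key : ∀ S ⊆ T.triangles, (volume : Measure Plane).restrict (⋃ K ∈ S, cell K)
      = ∑ K ∈ S, volume.restrict (cell K) := by
    intro S
    induction S using Finset.induction_on with
    | empty => simp
    | insert K S hK ih =>
      intro hS
      rw [Finset.insert_subset_iff] at hS
      rw [Finset.set_biUnion_insert, Measure.restrict_union₀, Finset.sum_insert hK, ih hS.2]
      · rw [AEDisjoint, Set.inter_iUnion₂]
        refine (measure_biUnion_null_iff S.countable_toSet).2 fun L hL => ?_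
        exact T.volume_inter hS.1 (hS.2 hL) (by rintro rfl; exact hK hL)
      · exact (S.measurableSet_biUnion fun L _ => measurableSet_cell L).nullMeasurableSet
  exact key _ subset_rfl

theorem setIntegral_eq_sum (hΩ : IsPolygonalDomain Ω) {f : Plane → ℝ}
    (hf : ∀ K ∈ T.triangles, IntegrableOn f (cell K)) :
    ∫ x in Ω, f x = ∑ K ∈ T.triangles, ∫ x in cell K, f x := by
  rw [T.restrict_eq_sum hΩ, integral_finsetSum_measure hf]

/-- `q K` are the coefficients of the quadratic polynomial that `v` is on the triangle `K`. -/
def HasCoeffs (v : Plane → ℝ) (q : Finset Plane → Fin 6 → ℝ) : Prop :=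
  ∀ K ∈ T.triangles, Set.EqOn v (quad (q K)) (cell K)

theorem exists_hasCoeffs {v : Plane → ℝ} (hv : v ∈ T.Zh) : ∃ q, T.HasCoeffs v q := by
  have : ∀ K, ∃ c, K ∈ T.triangles → Set.EqOn v (quad c) (cell K) := by
    intro K
    by_cases hK : K ∈ T.triangles
    · obtain ⟨p, hp, h⟩ := hv.2 K hK
      obtain ⟨c, hc⟩ := exists_quad_of_totalDegree_le hp
      exact ⟨c, fun _ x hx => (h x hx).trans (hc x)⟩
    · exact ⟨0, fun h => absurd h hK⟩
  choose q hq using this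
  exact ⟨q, fun K hK => hq K hK⟩

variable {T}

theorem HasCoeffs.add_mul {v w : Plane → ℝ} {p q : Finset Plane → Fin 6 → ℝ}
    (hv : T.HasCoeffs v p) (hw : T.HasCoeffs w q) (s : ℝ) :
    T.HasCoeffs (fun x => v x + s * w x) (p + s • q) := by
  intro K hK x hx
  dsimp only [Pi.add_apply, Pi.smul_apply]
  rw [quad_add, quad_smul, hv K hK hx, hw K hK hx]

theorem lagrange_add_mul {k : ℕ} {v w : Plane → ℝ} (hv : v ∈ T.lagrange k)
    (hw : w ∈ T.lagrange k) (s : ℝ) : (fun x => v x + s * w x) ∈ T.lagrange k := by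
  refine ⟨hv.1.add (continuousOn_const.mul hw.1), fun K hK => ?_⟩
  obtain ⟨p, hp, h⟩ := hv.2 K hK
  obtain ⟨q, hq, h'⟩ := hw.2 K hK
  refine ⟨p + MvPolynomial.C s * q, ?_, fun x hx => ?_⟩
  · refine (MvPolynomial.totalDegree_add _ _).trans (max_le hp ?_)
    refine (MvPolynomial.totalDegree_mul _ _).trans ?_
    simpa using hq
  · dsimp only
    rw [h x hx, h' x hx]
    simp

theorem gradIp_eq_sum (hΩ : IsPolygonalDomain Ω) {v w : Plane → ℝ}
    {p q : Finset Plane → Fin 6 → ℝ} (hv : T.HasCoeffs v p) (hw : T.HasCoeffs w q) :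
    gradIp Ω v w
      = ∑ K ∈ T.triangles, ∫ x in cell K, ⟪gradQ (p K) x, gradQ (q K) x⟫ := by
  have hae : ∀ K ∈ T.triangles, (fun x => ⟪gradQ (p K) x, gradQ (q K) x⟫)
      =ᵐ[volume.restrict (cell K)] fun x => ⟪gradient v x, gradient w x⟫ := by
    intro K hK
    filter_upwards [ae_mem_interior_cell K] with x hx
    rw [gradient_eq_gradQ (hv K hK) hx, gradient_eq_gradQ (hw K hK) hx]
  rw [gradIp, T.setIntegral_eq_sum hΩ]
  · exact Finset.sum_congr rfl fun K hK => (integral_congr_ae (hae K hK)).symm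
  · intro K hK
    exact (integrableOn_cell K ((continuous_gradQ _).inner (continuous_gradQ _))).congr (hae K hK)

theorem ip_self_eq_sum (hΩ : IsPolygonalDomain Ω) {v : Plane → ℝ}
    {q : Finset Plane → Fin 6 → ℝ} (hv : T.HasCoeffs v q) :
    ip Ω v v = ∑ K ∈ T.triangles, ∫ x in cell K, quad (q K) x ^ 2 := by
  have heq : ∀ K ∈ T.triangles, Set.EqOn (fun x => quad (q K) x ^ 2) (fun x => v x * v x)
      (cell K) := fun K hK x hx => by
    dsimp only
    rw [hv K hK hx, sq]
  rw [ip, T.setIntegral_eq_sum hΩ]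
  · exact Finset.sum_congr rfl fun K hK =>
      (setIntegral_congr_fun (measurableSet_cell K) (heq K hK)).symm
  · intro K hK
    exact (integrableOn_cell K ((continuous_quad _).pow 2)).congr_fun (heq K hK)
      (measurableSet_cell K)

end Triangulation

/-! ### The interior penalty form in terms of coefficients. -/

theorem frob_hessQ (c d : Fin 6 → ℝ) :
    frob (hessQ c) (hessQ d) = 4 * (c 3 * d 3) + 2 * (c 4 * d 4) + 4 * (c 5 * d 5) := by
  simp [frob, Fin.sum_univ_two, inner_plane]
  ring

theorem frob_hessQ_self_nonneg (c : Fin 6 → ℝ) : 0 ≤ frob (hessQ c) (hessQ c) := by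
  rw [frob_hessQ]
  nlinarith [mul_self_nonneg (c 3), mul_self_nonneg (c 4), mul_self_nonneg (c 5)]

/-- Cauchy–Schwarz for the Frobenius product of the Hessian with n ⊗ n, which has norm 1; the defect
is written as a sum of squares. -/
theorem sq_inner_hessQ_le (c : Fin 6 → ℝ) {n : Plane} (hn : ‖n‖ = 1) :
    ⟪n, hessQ c n⟫ ^ 2 ≤ frob (hessQ c) (hessQ c) := by
  have hnn : n 0 * n 0 + n 1 * n 1 = 1 := by
    rw [← inner_plane, real_inner_self_eq_norm_sq, hn, one_pow]
  rw [frob_hessQ, inner_plane, hessQ_zero, hessQ_one]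
  have h1 : (4 * (c 3 * c 3) + 2 * (c 4 * c 4) + 4 * (c 5 * c 5)) * (n 0 * n 0 + n 1 * n 1) ^ 2
      - (n 0 * (2 * c 3 * n 0 + c 4 * n 1) + n 1 * (c 4 * n 0 + 2 * c 5 * n 1)) ^ 2
      = 2 * (2 * c 3 * (n 0 * n 1) - c 4 * n 0 ^ 2) ^ 2
        + (2 * c 3 * n 1 ^ 2 - 2 * c 5 * n 0 ^ 2) ^ 2
        + 2 * (c 4 * n 1 ^ 2 - 2 * c 5 * (n 0 * n 1)) ^ 2 := by ring
  rw [hnn, one_pow, mul_one] at h1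
  have h2 : 0 ≤ 2 * (2 * c 3 * (n 0 * n 1) - c 4 * n 0 ^ 2) ^ 2
        + (2 * c 3 * n 1 ^ 2 - 2 * c 5 * n 0 ^ 2) ^ 2
        + 2 * (c 4 * n 1 ^ 2 - 2 * c 5 * (n 0 * n 1)) ^ 2 := by positivity
  linarith

namespace Triangulation

section edgeIntegral

variable {e : Finset Plane} {f g : Plane → ℝ}

theorem edgeIntegral_congr (h : Set.EqOn f g (cell e)) : edgeIntegral e f = edgeIntegral e g :=
  setIntegral_congr_fun (measurableSet_cell e) h

theorem edgeIntegral_add (he : e.card = 2) (hf : Continuous f) (hg : Continuous g) :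
    edgeIntegral e (fun x => f x + g x) = edgeIntegral e f + edgeIntegral e g :=
  integral_add (integrableOn_edge he hf) (integrableOn_edge he hg)

theorem edgeIntegral_const_mul (r : ℝ) :
    edgeIntegral e (fun x => r * f x) = r * edgeIntegral e f :=
  integral_const_mul _ _

theorem edgeIntegral_sum {ι : Type*} (he : e.card = 2) (s : Finset ι) {F : ι → Plane → ℝ}
    (hF : ∀ i ∈ s, Continuous (F i)) :
    edgeIntegral e (fun x => ∑ i ∈ s, F i x) = ∑ i ∈ s, edgeIntegral e (F i) :=
  integral_finsetSum s fun i hi => integrableOn_edge he (hF i hi)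

theorem edgeIntegral_mono (he : e.card = 2) (hf : Continuous f) (hg : Continuous g)
    (h : ∀ x, f x ≤ g x) : edgeIntegral e f ≤ edgeIntegral e g :=
  integral_mono (integrableOn_edge he hf) (integrableOn_edge he hg) h

theorem edgeIntegral_nonneg (h : ∀ x, 0 ≤ f x) : 0 ≤ edgeIntegral e f :=
  integral_nonneg h

theorem edgeIntegral_const (he : e.card = 2) (r : ℝ) :
    edgeIntegral e (fun _ => r) = r * diam e := by
  obtain ⟨b, c, -, rfl⟩ := Finset.card_eq_two.1 he
  rw [edgeIntegral_pair, diam_pair]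
  simp [mul_comm]

theorem diam_pos (he : e.card = 2) : 0 < diam e := by
  obtain ⟨b, c, hbc, rfl⟩ := Finset.card_eq_two.1 he
  rw [diam_pair]
  exact dist_pos.2 hbc

end edgeIntegral

variable {Ω : Set Plane} (T : Triangulation Ω)

/-- The jump of the normal derivative, in terms of the coefficients. -/
def jumpQ (e : Finset Plane) (q : Finset Plane → Fin 6 → ℝ) (x : Plane) : ℝ :=
  -∑ K ∈ T.adjacent e, ⟪outwardNormal K e, gradQ (q K) x⟫

/-- The average of the second normal derivative, in terms of the coefficients. -/
def avgQ (e : Finset Plane) (q : Finset Plane → Fin 6 → ℝ) : ℝ :=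
  ((T.adjacent e).card : ℝ)⁻¹ *
    ∑ K ∈ T.adjacent e, ⟪outwardNormal K e, hessQ (q K) (outwardNormal K e)⟫

theorem continuous_jumpQ (e : Finset Plane) (q : Finset Plane → Fin 6 → ℝ) :
    Continuous (T.jumpQ e q) :=
  (continuous_finsetSum _ fun _ _ => continuous_const.inner (continuous_gradQ _)).neg

theorem jumpQ_add_smul (e : Finset Plane) (p q : Finset Plane → Fin 6 → ℝ) (s : ℝ) (x : Plane) :
    T.jumpQ e (p + s • q) x = T.jumpQ e p x + s * T.jumpQ e q x := by
  simp only [jumpQ, Pi.add_apply, Pi.smul_apply, gradQ_add, gradQ_smul, inner_add_right,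
    real_inner_smul_right, Finset.sum_add_distrib, ← Finset.mul_sum]
  ring

theorem avgQ_add_smul (e : Finset Plane) (p q : Finset Plane → Fin 6 → ℝ) (s : ℝ) :
    T.avgQ e (p + s • q) = T.avgQ e p + s * T.avgQ e q := by
  simp only [avgQ, Pi.add_apply, Pi.smul_apply, hessQ_add, hessQ_smul, inner_add_right,
    real_inner_smul_right, Finset.sum_add_distrib, ← Finset.mul_sum,
    add_apply, smul_apply]
  ring

/-- The contribution of a triangle to the bilinear form. -/
def cellForm (K : Finset Plane) (p q : Finset Plane → Fin 6 → ℝ) : ℝ :=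
  volume.real (cell K) * frob (hessQ (p K)) (hessQ (q K))

/-- The consistency term on an edge. -/
def consForm (e : Finset Plane) (p q : Finset Plane → Fin 6 → ℝ) : ℝ :=
  T.avgQ e p * edgeIntegral e (T.jumpQ e q)

/-- The penalty term on an edge, without its weight. -/
def penForm (e : Finset Plane) (p q : Finset Plane → Fin 6 → ℝ) : ℝ :=
  edgeIntegral e fun x => T.jumpQ e p x * T.jumpQ e q x

theorem cellForm_add_smul (K : Finset Plane) (p q : Finset Plane → Fin 6 → ℝ) (s : ℝ) :
    cellForm K (p + s • q) (p + s • q)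
      = cellForm K p p + 2 * s * cellForm K p q + s ^ 2 * cellForm K q q := by
  simp only [cellForm, frob_hessQ, Pi.add_apply, Pi.smul_apply, smul_eq_mul]
  ring

theorem consForm_add_smul {e : Finset Plane} (he : e.card = 2)
    (p q : Finset Plane → Fin 6 → ℝ) (s : ℝ) :
    T.consForm e (p + s • q) (p + s • q)
      = T.consForm e p p + s * (T.consForm e p q + T.consForm e q p)
        + s ^ 2 * T.consForm e q q := by
  have h : edgeIntegral e (T.jumpQ e (p + s • q))
      = edgeIntegral e (T.jumpQ e p) + s * edgeIntegral e (T.jumpQ e q) := by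
    rw [← edgeIntegral_const_mul, ← edgeIntegral_add he (T.continuous_jumpQ e p)
      (continuous_const.fun_mul (T.continuous_jumpQ e q))]
    exact edgeIntegral_congr fun x _ => T.jumpQ_add_smul e p q s x
  rw [consForm, h, avgQ_add_smul]
  simp only [consForm]
  ring

theorem penForm_add_smul {e : Finset Plane} (he : e.card = 2)
    (p q : Finset Plane → Fin 6 → ℝ) (s : ℝ) :
    T.penForm e (p + s • q) (p + s • q)
      = T.penForm e p p + 2 * s * T.penForm e p q + s ^ 2 * T.penForm e q q := by
  have hp := T.continuous_jumpQ e p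
  have hq := T.continuous_jumpQ e q
  simp only [penForm]
  rw [← edgeIntegral_const_mul, ← edgeIntegral_const_mul, ← edgeIntegral_add he
    (hp.fun_mul hp) (continuous_const.fun_mul (hp.fun_mul hq)), ← edgeIntegral_add he
    ((hp.fun_mul hp).fun_add (continuous_const.fun_mul (hp.fun_mul hq)))
    (continuous_const.fun_mul (hq.fun_mul hq))]
  refine edgeIntegral_congr fun x _ => ?_
  rw [jumpQ_add_smul]
  ring

theorem cellForm_self_nonneg (K : Finset Plane) (p : Finset Plane → Fin 6 → ℝ) :
    0 ≤ cellForm K p p := mul_nonneg measureReal_nonneg (frob_hessQ_self_nonneg _)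

theorem penForm_self_nonneg (e : Finset Plane) (p : Finset Plane → Fin 6 → ℝ) :
    0 ≤ T.penForm e p p := edgeIntegral_nonneg fun _ => mul_self_nonneg _

variable {T}

section coefficients

variable {v w : Plane → ℝ} {p q : Finset Plane → Fin 6 → ℝ}

theorem HasCoeffs.jump_eq (hv : T.HasCoeffs v p) (e : Finset Plane) :
    Set.EqOn (T.jump e v) (T.jumpQ e p) (cell e) := by
  intro x hx
  rw [jump, jumpQ]
  congr 1
  refine Finset.sum_congr rfl fun K hK => ?_
  obtain ⟨hK, heK⟩ := T.mem_adjacent.1 hK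
  rw [grad_eq_gradQ (T.affineIndependent hK) (T.card_triangle hK) (hv K hK) (cell_mono heK hx)]

theorem HasCoeffs.avg_eq (hv : T.HasCoeffs v p) {e : Finset Plane} {x : Plane}
    (hx : x ∈ cell e) : T.avg e v x = T.avgQ e p := by
  rw [avg, avgQ]
  congr 1
  refine Finset.sum_congr rfl fun K hK => ?_
  obtain ⟨hK, heK⟩ := T.mem_adjacent.1 hK
  rw [hess_eq_hessQ (T.affineIndependent hK) (T.card_triangle hK) (hv K hK) (cell_mono heK hx)]

theorem HasCoeffs.setIntegral_frob_hess (hv : T.HasCoeffs v p) (hw : T.HasCoeffs w q)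
    {K : Finset Plane} (hK : K ∈ T.triangles) :
    ∫ x in cell K, frob (hess K v x) (hess K w x) = cellForm K p q := by
  rw [setIntegral_congr_fun (g := fun _ => frob (hessQ (p K)) (hessQ (q K)))
    (measurableSet_cell K), setIntegral_const, smul_eq_mul, cellForm]
  intro x hx
  dsimp only
  rw [hess_eq_hessQ (T.affineIndependent hK) (T.card_triangle hK) (hv K hK) hx,
    hess_eq_hessQ (T.affineIndependent hK) (T.card_triangle hK) (hw K hK) hx]

theorem HasCoeffs.edgeIntegral_avg_jump (hv : T.HasCoeffs v p) (hw : T.HasCoeffs w q)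
    (e : Finset Plane) :
    edgeIntegral e (fun x => T.avg e v x * T.jump e w x) = T.consForm e p q := by
  rw [consForm, ← edgeIntegral_const_mul]
  refine edgeIntegral_congr fun x hx => ?_
  rw [hv.avg_eq hx, hw.jump_eq e hx]

theorem HasCoeffs.edgeIntegral_jump_jump (hv : T.HasCoeffs v p) (hw : T.HasCoeffs w q)
    (e : Finset Plane) :
    edgeIntegral e (fun x => T.jump e v x * T.jump e w x) = T.penForm e p q := by
  refine edgeIntegral_congr fun x hx => ?_
  rw [hv.jump_eq e hx, hw.jump_eq e hx]

theorem HasCoeffs.aIP_eq (hv : T.HasCoeffs v p) (hw : T.HasCoeffs w q) (α : ℝ) :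
    T.aIP α v w = (∑ K ∈ T.triangles, cellForm K p q)
      + (∑ e ∈ T.edges, (T.consForm e p q + T.consForm e q p))
      + α * ∑ e ∈ T.edges, 1 / diam e * T.penForm e p q := by
  rw [aIP, Finset.sum_add_distrib, ← add_assoc]
  congr 1
  · congr 1
    · congr 1
      · exact Finset.sum_congr rfl fun K hK => hv.setIntegral_frob_hess hw hK
      · exact Finset.sum_congr rfl fun e _ => hv.edgeIntegral_avg_jump hw e
    · exact Finset.sum_congr rfl fun e _ => hw.edgeIntegral_avg_jump hv e
  · congr 1
    refine Finset.sum_congr rfl fun e _ => ?_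
    rw [hv.edgeIntegral_jump_jump hw e]

theorem HasCoeffs.normSq2h_eq (hv : T.HasCoeffs v p) (α : ℝ) :
    T.normSq2h α v = (∑ K ∈ T.triangles, cellForm K p p)
      + ∑ e ∈ T.edges, α / diam e * T.penForm e p p := by
  rw [normSq2h]
  congr 1
  · exact Finset.sum_congr rfl fun K hK => hv.setIntegral_frob_hess hv hK
  · refine Finset.sum_congr rfl fun e _ => ?_
    rw [← hv.edgeIntegral_jump_jump hv e]
    simp only [sq]

end coefficients

theorem normSq2h_nonneg {α : ℝ} (hα : 0 ≤ α) {v : Plane → ℝ} (hv : v ∈ T.Zh) :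
    0 ≤ T.normSq2h α v := by
  obtain ⟨p, hp⟩ := T.exists_hasCoeffs hv
  rw [hp.normSq2h_eq]
  refine add_nonneg (Finset.sum_nonneg fun K _ => cellForm_self_nonneg K p)
    (Finset.sum_nonneg fun e _ => mul_nonneg (div_nonneg hα Metric.diam_nonneg)
      (T.penForm_self_nonneg e p))

/-- The expansion of a symmetric quadratic form. The energy argument uses it to express the cross
term between the new iterate and the increment through energies. -/
theorem aIP_add_mul (α : ℝ) {v w : Plane → ℝ} (hv : v ∈ T.Zh) (hw : w ∈ T.Zh) (s : ℝ) :
    T.aIP α (fun x => v x + s * w x) (fun x => v x + s * w x)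
      = T.aIP α v v + 2 * s * T.aIP α v w + s ^ 2 * T.aIP α w w := by
  obtain ⟨p, hp⟩ := T.exists_hasCoeffs hv
  obtain ⟨q, hq⟩ := T.exists_hasCoeffs hw
  rw [(hp.add_mul hq s).aIP_eq (hp.add_mul hq s), hp.aIP_eq hp, hp.aIP_eq hq, hq.aIP_eq hq]
  have h1 : ∑ K ∈ T.triangles, cellForm K (p + s • q) (p + s • q)
      = (∑ K ∈ T.triangles, cellForm K p p) + 2 * s * (∑ K ∈ T.triangles, cellForm K p q)
        + s ^ 2 * ∑ K ∈ T.triangles, cellForm K q q := by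
    simp only [Finset.mul_sum, ← Finset.sum_add_distrib, cellForm_add_smul]
  have h2 : ∑ e ∈ T.edges, (T.consForm e (p + s • q) (p + s • q)
        + T.consForm e (p + s • q) (p + s • q))
      = (∑ e ∈ T.edges, (T.consForm e p p + T.consForm e p p))
        + 2 * s * (∑ e ∈ T.edges, (T.consForm e p q + T.consForm e q p))
        + s ^ 2 * ∑ e ∈ T.edges, (T.consForm e q q + T.consForm e q q) := by
    simp only [Finset.mul_sum, ← Finset.sum_add_distrib]
    refine Finset.sum_congr rfl fun e he => ?_
    rw [T.consForm_add_smul (T.mem_edges.1 he).2]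
    ring
  have h3 : ∑ e ∈ T.edges, 1 / diam e * T.penForm e (p + s • q) (p + s • q)
      = (∑ e ∈ T.edges, 1 / diam e * T.penForm e p p)
        + 2 * s * (∑ e ∈ T.edges, 1 / diam e * T.penForm e p q)
        + s ^ 2 * ∑ e ∈ T.edges, 1 / diam e * T.penForm e q q := by
    simp only [Finset.mul_sum, ← Finset.sum_add_distrib]
    refine Finset.sum_congr rfl fun e he => ?_
    rw [T.penForm_add_smul (T.mem_edges.1 he).2]
    ring
  rw [h1, h2, h3]
  ring

/-! ### Coercivity of the interior penalty form. -/

theorem diam_sq_mul_le {σ : ℝ} (hσ : 0 < σ) (hT : T.ShapeRegular σ) {K e : Finset Plane}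
    (hK : K ∈ T.triangles) (he : e ⊆ K) :
    diam e ^ 2 ≤ σ ^ 2 / Real.pi * volume.real (cell K) := by
  obtain ⟨x, hx⟩ := hT K hK
  refine le_trans ?_ (diam_sq_le_volume hσ hx)
  exact pow_le_pow_left₀ Metric.diam_nonneg (diam_mono he) 2

theorem sum_edges_adjacent (g : Finset Plane → ℝ) :
    ∑ e ∈ T.edges, ∑ K ∈ T.adjacent e, g K = 3 * ∑ K ∈ T.triangles, g K := by
  rw [← T.sum_triangles_sum_edges fun K _ => g K, Finset.mul_sum]
  refine Finset.sum_congr rfl fun K hK => ?_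
  rw [Finset.sum_const, Finset.card_powersetCard, T.card_triangle hK]
  norm_num [Nat.choose]

theorem outwardNormal_spec {K e : Finset Plane} (he : e ∈ T.edges) (hK : K ∈ T.adjacent e) :
    IsOutwardNormal K e (outwardNormal K e) := by
  obtain ⟨hK, heK⟩ := T.mem_adjacent.1 hK
  exact isOutwardNormal_outwardNormal (T.affineIndependent hK) (T.card_triangle hK) heK
    (T.mem_edges.1 he).2

/-- The square of a mean is at most the mean of the squares, hence at most their sum, for any
positive number of triangles at the edge. -/
theorem avgQ_sq_le {e : Finset Plane} (he : e ∈ T.edges) (p : Finset Plane → Fin 6 → ℝ) :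
    T.avgQ e p ^ 2 ≤ ∑ K ∈ T.adjacent e, frob (hessQ (p K)) (hessQ (p K)) := by
  have hn : (1 : ℝ) ≤ (T.adjacent e).card := by
    exact_mod_cast Finset.card_pos.2 (T.adjacent_nonempty he)
  have h1 := sq_sum_le_card_mul_sum_sq (s := T.adjacent e)
    (f := fun K => ⟪outwardNormal K e, hessQ (p K) (outwardNormal K e)⟫)
  have h2 : ∑ K ∈ T.adjacent e, ⟪outwardNormal K e, hessQ (p K) (outwardNormal K e)⟫ ^ 2
      ≤ ∑ K ∈ T.adjacent e, frob (hessQ (p K)) (hessQ (p K)) :=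
    Finset.sum_le_sum fun K hK => sq_inner_hessQ_le _ (T.outwardNormal_spec he hK).1
  have h3 : 0 ≤ ∑ K ∈ T.adjacent e, frob (hessQ (p K)) (hessQ (p K)) :=
    Finset.sum_nonneg fun K _ => frob_hessQ_self_nonneg _
  rw [avgQ, mul_pow, inv_pow, inv_mul_le_iff₀ (by positivity)]
  refine h1.trans ?_
  rw [sq, mul_assoc]
  apply mul_le_mul_of_nonneg_left _ (by positivity)
  nlinarith

/-- The Hessians being constant, |e|² ≤ (σ²/π)|K| plays the role of a trace inequality. The factor 3
appears because each triangle is counted once for each of its edges. -/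
theorem sum_diam_sq_mul_avgQ_sq_le {σ : ℝ} (hσ : 0 < σ) (hT : T.ShapeRegular σ)
    (p : Finset Plane → Fin 6 → ℝ) :
    ∑ e ∈ T.edges, diam e ^ 2 * T.avgQ e p ^ 2
      ≤ 3 * (σ ^ 2 / Real.pi) * ∑ K ∈ T.triangles, cellForm K p p := by
  rw [mul_assoc, Finset.mul_sum (s := T.triangles), ← T.sum_edges_adjacent]
  refine Finset.sum_le_sum fun e he => ?_
  refine (mul_le_mul_of_nonneg_left (T.avgQ_sq_le he p) (sq_nonneg _)).trans ?_
  rw [Finset.mul_sum]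
  refine Finset.sum_le_sum fun K hK => ?_
  obtain ⟨hK, heK⟩ := T.mem_adjacent.1 hK
  rw [cellForm, ← mul_assoc]
  exact mul_le_mul_of_nonneg_right (diam_sq_mul_le hσ hT hK heK) (frob_hessQ_self_nonneg _)

/-- Young's inequality pointwise on the edge with weight δ|e|; the average is constant there, so
integration produces the second factor |e|. -/
theorem neg_consForm_le {e : Finset Plane} (he : e ∈ T.edges) (p : Finset Plane → Fin 6 → ℝ)
    {δ : ℝ} (hδ : 0 < δ) :
    -(2 * T.consForm e p p) ≤ δ * (diam e ^ 2 * T.avgQ e p ^ 2)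
      + 1 / δ * (1 / diam e * T.penForm e p p) := by
  have he2 := (T.mem_edges.1 he).2
  have hd := diam_pos he2
  have hj := T.continuous_jumpQ e p
  have h1 : -(2 * T.consForm e p p)
      = edgeIntegral e (fun x => -(2 * T.avgQ e p) * T.jumpQ e p x) := by
    rw [edgeIntegral_const_mul, consForm]
    ring
  have h2 : δ * (diam e ^ 2 * T.avgQ e p ^ 2) + 1 / δ * (1 / diam e * T.penForm e p p)
      = edgeIntegral e (fun x => δ * diam e * T.avgQ e p ^ 2
        + 1 / (δ * diam e) * (T.jumpQ e p x * T.jumpQ e p x)) := by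
    rw [edgeIntegral_add he2 continuous_const (continuous_const.fun_mul (hj.fun_mul hj)),
      edgeIntegral_const he2, edgeIntegral_const_mul, penForm]
    field_simp
  rw [h1, h2]
  refine edgeIntegral_mono he2 (by fun_prop) (by fun_prop) fun x => ?_
  set A := T.avgQ e p
  set J := T.jumpQ e p x
  have hk : 0 < δ * diam e := mul_pos hδ hd
  have h3 : δ * diam e * A ^ 2 + 1 / (δ * diam e) * (J * J) - -(2 * A) * J
      = 1 / (δ * diam e) * (δ * diam e * A + J) ^ 2 := by
    field_simp
    ring
  have h4 : 0 ≤ 1 / (δ * diam e) * (δ * diam e * A + J) ^ 2 := by positivity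
  linarith

/-- The interior penalty form is coercive when the penalty parameter is large. -/
theorem coercive_half {σ : ℝ} (hσ : 0 < σ) (hT : T.ShapeRegular σ) {α : ℝ}
    (hα : 12 * (σ ^ 2 / Real.pi) ≤ α) : T.Coercive α (1 / 2) := by
  intro w hw
  obtain ⟨p, hp⟩ := T.exists_hasCoeffs hw
  rw [hp.normSq2h_eq, hp.aIP_eq hp]
  have hpi := Real.pi_pos
  set k := σ ^ 2 / Real.pi with hk
  have hk0 : 0 < k := by positivity
  set H := ∑ K ∈ T.triangles, cellForm K p p with hH
  set P := ∑ e ∈ T.edges, 1 / diam e * T.penForm e p p with hP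
  have hP0 : 0 ≤ P := Finset.sum_nonneg fun e _ =>
    mul_nonneg (one_div_nonneg.2 Metric.diam_nonneg) (T.penForm_self_nonneg e p)
  have h1 : ∑ e ∈ T.edges, α / diam e * T.penForm e p p = α * P := by
    rw [hP, Finset.mul_sum]
    exact Finset.sum_congr rfl fun e _ => by ring
  -- The choice δ = 1/(6k) leaves exactly H/2 of the Hessian part, and its price 6kP is at most αP/2
  -- by the assumption on α.
  have h2 : -∑ e ∈ T.edges, (T.consForm e p p + T.consForm e p p) ≤ 1 / 2 * H + 6 * k * P := by
    rw [← Finset.sum_neg_distrib]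
    calc ∑ e ∈ T.edges, -(T.consForm e p p + T.consForm e p p)
        ≤ ∑ e ∈ T.edges, (1 / (6 * k) * (diam e ^ 2 * T.avgQ e p ^ 2)
            + 1 / (1 / (6 * k)) * (1 / diam e * T.penForm e p p)) := by
          refine Finset.sum_le_sum fun e he => ?_
          rw [← two_mul]
          exact neg_consForm_le he p (by positivity)
      _ = 1 / (6 * k) * (∑ e ∈ T.edges, diam e ^ 2 * T.avgQ e p ^ 2) + 6 * k * P := by
          rw [Finset.sum_add_distrib, ← Finset.mul_sum, ← Finset.mul_sum, one_div_one_div]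
      _ ≤ 1 / (6 * k) * (3 * k * H) + 6 * k * P := by
          have := sum_diam_sq_mul_avgQ_sq_le hσ hT p
          gcongr
      _ = 1 / 2 * H + 6 * k * P := by
          field_simp
          ring
  rw [h1]
  nlinarith

end Triangulation

/-! ### Green's formula and the interpolation inequality. -/

/-- The divergence theorem for v ∂_i v in the i-th coordinate direction; the sum over i is Green's
formula for the field v∇v. -/
theorem integral_green_coord {K : Finset Plane} (hind : AffineIndependent ℝ ((↑) : K → Plane))
    (hK3 : K.card = 3) (c : Fin 6 → ℝ) (i : Fin 2) :
    ∫ x in cell K, (quad c x * hessQ c (EuclideanSpace.single i 1) i + gradQ c x i * gradQ c x i)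
      = ∑ e ∈ K.powersetCard 2, outwardNormal K e i
          * Triangulation.edgeIntegral e fun x => quad c x * gradQ c x i := by
  have hcd : ContDiff ℝ 1 fun x => quad c x * gradQ c x i := by
    fin_cases i
    · simp only [Fin.zero_eta, gradQ_zero, quad]
      fun_prop
    · simp only [Fin.mk_one, gradQ_one, quad]
      fun_prop
  have h := integral_fderiv_eq_sum_edgeIntegral hind hK3 hcd (EuclideanSpace.single i 1)
  have hder : ∀ x, fderiv ℝ (fun x => quad c x * gradQ c x i) x (EuclideanSpace.single i 1)
      = quad c x * hessQ c (EuclideanSpace.single i 1) i + gradQ c x i * gradQ c x i := by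
    intro x
    have h1 := hasGradientAt_iff_hasFDerivAt.1 (hasGradientAt_quad c x)
    have h2 := ((EuclideanSpace.proj i : Plane →L[ℝ] ℝ).hasFDerivAt).comp x
      (hasFDerivAt_gradQ c x)
    have h3 := (h1.mul h2).fderiv
    have h4 : (fun x => quad c x * gradQ c x i)
        = quad c * ((EuclideanSpace.proj i : Plane →L[ℝ] ℝ) ∘ gradQ c) := rfl
    rw [h4, h3]
    simp [EuclideanSpace.inner_single_right]
  simp only [hder, EuclideanSpace.inner_single_left, map_one, one_mul] at h
  exact h

/-- Green's formula on a triangle, for a quadratic polynomial. -/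
theorem integral_green {K : Finset Plane} (hind : AffineIndependent ℝ ((↑) : K → Plane))
    (hK3 : K.card = 3) (c : Fin 6 → ℝ) :
    ∫ x in cell K, ⟪gradQ c x, gradQ c x⟫
      = -(∫ x in cell K, quad c x * (2 * c 3 + 2 * c 5))
        + ∑ e ∈ K.powersetCard 2, Triangulation.edgeIntegral e
            fun x => quad c x * ⟪outwardNormal K e, gradQ c x⟫ := by
  have hq := continuous_quad c
  have hg : ∀ i : Fin 2, Continuous fun x => gradQ c x i := fun i =>
    (EuclideanSpace.proj i : Plane →L[ℝ] ℝ).continuous.comp (continuous_gradQ c)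
  have hint : ∀ i : Fin 2, IntegrableOn (fun x => quad c x *
      hessQ c (EuclideanSpace.single i 1) i + gradQ c x i * gradQ c x i) (cell K) := fun i =>
    integrableOn_cell K ((hq.mul continuous_const).add ((hg i).mul (hg i)))
  have h0 := integral_green_coord hind hK3 c 0
  have h1 := integral_green_coord hind hK3 c 1
  have hsum := integral_add (hint 0) (hint 1)
  have hlhs : ∫ x in cell K, ((quad c x * hessQ c (EuclideanSpace.single 0 1) 0
        + gradQ c x 0 * gradQ c x 0) + (quad c x * hessQ c (EuclideanSpace.single 1 1) 1
        + gradQ c x 1 * gradQ c x 1))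
      = (∫ x in cell K, ⟪gradQ c x, gradQ c x⟫)
        + ∫ x in cell K, quad c x * (2 * c 3 + 2 * c 5) := by
    rw [← integral_add (integrableOn_cell K ((continuous_gradQ c).inner (continuous_gradQ c)))
      (integrableOn_cell K (hq.fun_mul continuous_const))]
    refine integral_congr_ae (Filter.Eventually.of_forall fun x => ?_)
    dsimp only
    rw [inner_plane]
    simp
    ring
  have hrhs : ∀ e ∈ K.powersetCard 2, Triangulation.edgeIntegral e
      (fun x => quad c x * ⟪outwardNormal K e, gradQ c x⟫)
      = outwardNormal K e 0 * Triangulation.edgeIntegral e (fun x => quad c x * gradQ c x 0)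
        + outwardNormal K e 1 * Triangulation.edgeIntegral e (fun x => quad c x * gradQ c x 1) := by
    intro e he
    rw [← Triangulation.edgeIntegral_const_mul, ← Triangulation.edgeIntegral_const_mul,
      ← Triangulation.edgeIntegral_add (Finset.mem_powersetCard.1 he).2
        (continuous_const.fun_mul (hq.fun_mul (hg 0))) (continuous_const.fun_mul (hq.fun_mul (hg 1)))]
    congr 1
    funext x
    rw [inner_plane]
    ring
  rw [Finset.sum_congr rfl hrhs, Finset.sum_add_distrib, ← h0, ← h1]
  linarith

namespace Triangulation

variable {Ω : Set Plane} {T : Triangulation Ω}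

/-- The scaled inverse trace inequality on a shape regular triangle. -/
theorem diam_mul_edgeIntegral_sq_le {σ : ℝ} (hσ : 0 < σ) (hT : T.ShapeRegular σ)
    {K e : Finset Plane} (he : e ∈ T.edges) (hK : K ∈ T.adjacent e) (q : Fin 6 → ℝ) :
    diam e * edgeIntegral e (fun x => quad q x ^ 2)
      ≤ 9 * (σ ^ 2 / Real.pi) * ∫ x in cell K, quad q x ^ 2 := by
  obtain ⟨hKT, heK⟩ := T.mem_adjacent.1 hK
  have he2 := (T.mem_edges.1 he).2
  have hK3 := T.card_triangle hKT
  have hint := interior_cell_nonempty (T.affineIndependent hKT) hK3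
  have hd := diam_sq_mul_le hσ hT hKT heK
  -- The vertex opposite to e comes first in the coordinates, as `trace_le` bounds the trace on the
  -- edge opposite to a.
  obtain ⟨a, ha⟩ := Finset.card_eq_one.1
    (show (K \ e).card = 1 by rw [Finset.card_sdiff_of_subset heK, hK3, he2])
  have hKe : K = insert a e := by
    rw [← Finset.sdiff_union_of_subset heK, ha]
    rfl
  obtain ⟨b, c, -, rfl⟩ := Finset.card_eq_two.1 he2
  subst hKe
  rw [volume_real_cell hint] at hd
  have htr := trace_le q hint
  rw [edgeIntegral_pair, diam_pair] at *
  set I := ∫ t in (0 : ℝ)..1, quad q (AffineMap.lineMap b c t) ^ 2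
  have hI : 0 ≤ I := intervalIntegral.integral_nonneg zero_le_one fun t _ => sq_nonneg _
  have hpi := Real.pi_pos
  set k := σ ^ 2 / Real.pi
  have hk : 0 < k := by positivity
  calc dist b c * (dist b c * I) = dist b c ^ 2 * I := by ring
    _ ≤ (k * (|cross (b - a) (c - a)| / 2)) * I := mul_le_mul_of_nonneg_right hd hI
    _ = k / 2 * (|cross (b - a) (c - a)| * I) := by ring
    _ ≤ k / 2 * (18 * ∫ x in cell {a, b, c}, quad q x ^ 2) :=
        mul_le_mul_of_nonneg_left htr (by positivity)
    _ = 9 * k * ∫ x in cell {a, b, c}, quad q x ^ 2 := by ring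

/-- By continuity all triangles at e give v the same trace, which factors out of the sum; what is
left is the jump up to sign. On a boundary edge the sum has one term and the formula persists. -/
theorem sum_edgeIntegral_eq_jump {v : Plane → ℝ} {q : Finset Plane → Fin 6 → ℝ}
    (hv : T.HasCoeffs v q) {e L : Finset Plane} (he : e ∈ T.edges) (hL : L ∈ T.adjacent e) :
    ∑ K ∈ T.adjacent e, edgeIntegral e (fun x => quad (q K) x * ⟪outwardNormal K e, gradQ (q K) x⟫)
      = edgeIntegral e (fun x => -(quad (q L) x * T.jumpQ e q x)) := by
  rw [← edgeIntegral_sum (T.mem_edges.1 he).2 _ fun K _ =>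
    (continuous_quad (q K)).fun_mul (continuous_const.inner (continuous_gradQ (q K)))]
  refine edgeIntegral_congr fun x hx => ?_
  have h : ∀ K ∈ T.adjacent e, quad (q K) x = v x := fun K hK => by
    obtain ⟨hK, heK⟩ := T.mem_adjacent.1 hK
    exact (hv K hK (cell_mono heK hx)).symm
  rw [jumpQ, mul_neg, neg_neg, Finset.mul_sum]
  exact Finset.sum_congr rfl fun K hK => by rw [h K hK, h L hL]

/-- Young's inequality with weights η/|e| and |e|/(4η): the first matches the penalty, where α ≥ 1
is used, and the second the scaled trace inequality. -/
theorem edge_term_le {σ : ℝ} (hσ : 0 < σ) (hT : T.ShapeRegular σ) {α η : ℝ} (hα : 1 ≤ α)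
    (hη : 0 < η) {v : Plane → ℝ} {q : Finset Plane → Fin 6 → ℝ} (hv : T.HasCoeffs v q)
    {e : Finset Plane} (he : e ∈ T.edges) :
    ∑ K ∈ T.adjacent e, edgeIntegral e (fun x => quad (q K) x * ⟪outwardNormal K e, gradQ (q K) x⟫)
      ≤ η * (α / diam e * T.penForm e q q)
        + 9 * (σ ^ 2 / Real.pi) / (4 * η)
          * ∑ K ∈ T.adjacent e, ∫ x in cell K, quad (q K) x ^ 2 := by
  obtain ⟨L, hL⟩ := T.adjacent_nonempty he
  have he2 := (T.mem_edges.1 he).2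
  have hd := diam_pos he2
  have hj := T.continuous_jumpQ e q
  have hq := continuous_quad (q L)
  have hpi := Real.pi_pos
  have hk : 0 < σ ^ 2 / Real.pi := by positivity
  rw [sum_edgeIntegral_eq_jump hv he hL]
  calc edgeIntegral e (fun x => -(quad (q L) x * T.jumpQ e q x))
      ≤ edgeIntegral e (fun x => η / diam e * (T.jumpQ e q x * T.jumpQ e q x)
          + diam e / (4 * η) * quad (q L) x ^ 2) := by
        refine edgeIntegral_mono he2 (by fun_prop) (by fun_prop) fun x => ?_
        set J := T.jumpQ e q x
        set u := quad (q L) x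
        have h1 : η / diam e * (J * J) + diam e / (4 * η) * u ^ 2 - -(u * J)
            = η / diam e * (J + diam e / (2 * η) * u) ^ 2 := by
          field_simp
          ring
        have h2 : 0 ≤ η / diam e * (J + diam e / (2 * η) * u) ^ 2 := by positivity
        linarith
    _ = η * (1 / diam e * T.penForm e q q)
          + 1 / (4 * η) * (diam e * edgeIntegral e (fun x => quad (q L) x ^ 2)) := by
        rw [edgeIntegral_add he2 (continuous_const.fun_mul (hj.fun_mul hj))
          (continuous_const.fun_mul (hq.fun_pow 2)), edgeIntegral_const_mul, edgeIntegral_const_mul,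
          penForm]
        ring
    _ ≤ η * (α / diam e * T.penForm e q q)
          + 1 / (4 * η) * (9 * (σ ^ 2 / Real.pi)
            * ∑ K ∈ T.adjacent e, ∫ x in cell K, quad (q K) x ^ 2) := by
        have hp := T.penForm_self_nonneg e q
        have h1 := diam_mul_edgeIntegral_sq_le hσ hT he hL (q L)
        have h2 : ∫ x in cell L, quad (q L) x ^ 2
            ≤ ∑ K ∈ T.adjacent e, ∫ x in cell K, quad (q K) x ^ 2 :=
          Finset.single_le_sum (f := fun K => ∫ x in cell K, quad (q K) x ^ 2)
            (fun K _ => integral_nonneg fun x => sq_nonneg _) hL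
        have h3 := h1.trans (mul_le_mul_of_nonneg_left h2 (by positivity))
        gcongr
    _ = _ := by ring

/-- The interpolation inequality between the broken `H²` norm and the `L²` norm. -/
theorem gradIp_self_le (hΩ : IsPolygonalDomain Ω) {σ : ℝ} (hσ : 0 < σ) (hT : T.ShapeRegular σ)
    {α η : ℝ} (hα : 1 ≤ α) (hη : 0 < η) {v : Plane → ℝ} (hv : v ∈ T.Zh) :
    gradIp Ω v v ≤ η * T.normSq2h α v
      + (1 / (2 * η) + 27 * (σ ^ 2 / Real.pi) / (4 * η)) * ip Ω v v := by
  obtain ⟨q, hq⟩ := T.exists_hasCoeffs hv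
  have h1 : gradIp Ω v v
      = (∑ K ∈ T.triangles, -∫ x in cell K, quad (q K) x * (2 * q K 3 + 2 * q K 5))
        + ∑ e ∈ T.edges, ∑ K ∈ T.adjacent e, edgeIntegral e
            (fun x => quad (q K) x * ⟪outwardNormal K e, gradQ (q K) x⟫) := by
    rw [gradIp_eq_sum hΩ hq hq, ← T.sum_triangles_sum_edges fun K e => edgeIntegral e
            (fun x => quad (q K) x * ⟪outwardNormal K e, gradQ (q K) x⟫), ← Finset.sum_add_distrib]
    exact Finset.sum_congr rfl fun K hK =>
      integral_green (T.affineIndependent hK) (T.card_triangle hK) (q K)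
  have h2 : ∑ K ∈ T.triangles, -∫ x in cell K, quad (q K) x * (2 * q K 3 + 2 * q K 5)
      ≤ ∑ K ∈ T.triangles, (η * cellForm K q q
          + 1 / (2 * η) * ∫ x in cell K, quad (q K) x ^ 2) := by
    refine Finset.sum_le_sum fun K _ => ?_
    have hc := continuous_quad (q K)
    have h3 : η * cellForm K q q + 1 / (2 * η) * ∫ x in cell K, quad (q K) x ^ 2
        = ∫ x in cell K, (η * frob (hessQ (q K)) (hessQ (q K))
            + 1 / (2 * η) * quad (q K) x ^ 2) := by
      rw [integral_add (integrableOn_cell K continuous_const)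
        (integrableOn_cell K (continuous_const.fun_mul (hc.fun_pow 2))),
        integral_const_mul (1 / (2 * η)),
        setIntegral_const, cellForm, smul_eq_mul]
      ring
    rw [h3, ← integral_neg]
    refine integral_mono (integrableOn_cell K (by fun_prop)) (integrableOn_cell K (by fun_prop))
      fun x => ?_
    dsimp only
    rw [frob_hessQ]
    set u := quad (q K) x
    set a := q K 3
    set b := q K 4
    set d := q K 5
    -- Young's inequality for -vΔv together with (Δv)² ≤ 2|∇²v|², with the defect as a sum of
    -- squares.
    have h4 : η * (4 * (a * a) + 2 * (b * b) + 4 * (d * d)) + 1 / (2 * η) * u ^ 2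
        - -(u * (2 * a + 2 * d))
        = 1 / (2 * η) * (u + η * (2 * a + 2 * d)) ^ 2
          + 2 * η * ((a - d) ^ 2 + b ^ 2) := by
      field_simp
      ring
    have h5 : 0 ≤ 1 / (2 * η) * (u + η * (2 * a + 2 * d)) ^ 2
          + 2 * η * ((a - d) ^ 2 + b ^ 2) := by positivity
    linarith
  have h3 := Finset.sum_le_sum fun e he => edge_term_le hσ hT hα hη hq (e := e) he
  -- Three edges per triangle turn the trace constant 9 into 27.
  rw [Finset.sum_add_distrib, ← Finset.mul_sum, ← Finset.mul_sum,
    T.sum_edges_adjacent fun K => ∫ x in cell K, quad (q K) x ^ 2] at h3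
  rw [Finset.sum_add_distrib, ← Finset.mul_sum, ← Finset.mul_sum] at h2
  rw [h1, hq.normSq2h_eq, ip_self_eq_sum hΩ hq]
  refine (add_le_add h2 h3).trans (le_of_eq ?_)
  ring

theorem gradIp_add_mul (hΩ : IsPolygonalDomain Ω) {v w : Plane → ℝ} (hv : v ∈ T.Zh)
    (hw : w ∈ T.Zh) (s : ℝ) :
    gradIp Ω (fun x => v x + s * w x) (fun x => v x + s * w x)
      = gradIp Ω v v + 2 * s * gradIp Ω v w + s ^ 2 * gradIp Ω w w := by
  obtain ⟨p, hp⟩ := T.exists_hasCoeffs hv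
  obtain ⟨q, hq⟩ := T.exists_hasCoeffs hw
  have hpq := hp.add_mul hq s
  rw [gradIp_eq_sum hΩ hpq hpq, gradIp_eq_sum hΩ hp hp, gradIp_eq_sum hΩ hp hq,
    gradIp_eq_sum hΩ hq hq]
  simp only [Finset.mul_sum, ← Finset.sum_add_distrib]
  refine Finset.sum_congr rfl fun K _ => ?_
  have h : ∀ a b : Fin 6 → ℝ, IntegrableOn (fun x => ⟪gradQ a x, gradQ b x⟫) (cell K) := fun a b =>
    integrableOn_cell K ((continuous_gradQ a).inner (continuous_gradQ b))
  have h' : IntegrableOn (fun x => ⟪gradQ (p K) x, gradQ (p K) x⟫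
      + 2 * s * ⟪gradQ (p K) x, gradQ (q K) x⟫) (cell K) := (h _ _).add ((h _ _).const_mul _)
  rw [← integral_const_mul, ← integral_const_mul,
    ← integral_add (h _ _) ((h _ _).const_mul _), ← integral_add h' ((h _ _).const_mul _)]
  refine integral_congr_ae (Filter.Eventually.of_forall fun x => ?_)
  simp only [Pi.add_apply, Pi.smul_apply, gradQ_add, gradQ_smul, inner_add_left, inner_add_right,
    real_inner_smul_left, real_inner_smul_right, real_inner_comm (gradQ (p K) x) (gradQ (q K) x)]
  ring

end Triangulation

/-! ### Norms over Ω as integrals. -/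

section norms

variable {Ω : Set Plane}

theorem normL_pow {F : Type*} [NormedAddCommGroup F] {u : Plane → F} (n : ℕ) [NeZero n]
    (hu : AEStronglyMeasurable u (volume.restrict Ω)) :
    normL n Ω u ^ n = ∫ x in Ω, ‖u x‖ ^ n := by
  have hn : n ≠ 0 := NeZero.ne n
  rw [normL, lpNorm_eq_integral_norm_rpow_toReal (by exact_mod_cast hn) (by simp) hu]
  simp only [ENNReal.toReal_natCast, Real.rpow_natCast]
  exact Real.rpow_inv_natCast_pow (integral_nonneg fun x => by positivity) hn

theorem normL_two_sq {u : Plane → ℝ} (hu : AEStronglyMeasurable u (volume.restrict Ω)) :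
    normL 2 Ω u ^ 2 = ip Ω u u := by
  have := normL_pow 2 hu
  simpa [ip, ← sq] using this

theorem normL_four_pow {u : Plane → ℝ} (hu : AEStronglyMeasurable u (volume.restrict Ω)) :
    normL 4 Ω u ^ 4 = ∫ x in Ω, u x ^ 4 := by
  have := normL_pow 4 hu
  simpa [Even.pow_abs (show Even 4 by decide)] using this

theorem measurable_gradient (u : Plane → ℝ) : Measurable (gradient u) :=
  ((InnerProductSpace.toDual ℝ Plane).symm.continuous.measurable).comp (measurable_fderiv ℝ u)

theorem normL_gradient_sq (u : Plane → ℝ) : normL 2 Ω (gradient u) ^ 2 = gradIp Ω u u := by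
  have := normL_pow (Ω := Ω) 2 (measurable_gradient u).aestronglyMeasurable
  simpa [gradIp] using this

theorem ip_self_nonneg (u : Plane → ℝ) : 0 ≤ ip Ω u u :=
  integral_nonneg fun x => mul_self_nonneg (u x)

theorem IsPolygonalDomain.integrableOn (hΩ : IsPolygonalDomain Ω) {f : Plane → ℝ}
    (hf : ContinuousOn f (closure Ω)) : IntegrableOn f Ω :=
  (hf.integrableOn_compact hΩ.isBounded.isCompact_closure).mono_set subset_closure

theorem ip_add_mul (hΩ : IsPolygonalDomain Ω) {v w : Plane → ℝ}
    (hv : ContinuousOn v (closure Ω)) (hw : ContinuousOn w (closure Ω)) (s : ℝ) :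
    ip Ω (fun x => v x + s * w x) (fun x => v x + s * w x)
      = ip Ω v v + 2 * s * ip Ω v w + s ^ 2 * ip Ω w w := by
  simp only [ip]
  rw [← integral_const_mul, ← integral_const_mul,
    ← integral_add (hΩ.integrableOn (by fun_prop)) (hΩ.integrableOn (by fun_prop)),
    ← integral_add (hΩ.integrableOn (by fun_prop)) (hΩ.integrableOn (by fun_prop))]
  congr 1
  funext x
  ring

theorem IsPolygonalDomain.aestronglyMeasurable (hΩ : IsPolygonalDomain Ω) {f : Plane → ℝ}
    (hf : ContinuousOn f (closure Ω)) : AEStronglyMeasurable f (volume.restrict Ω) :=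
  (hf.mono subset_closure).aestronglyMeasurable hΩ.isOpen.measurableSet

/-- Pointwise A u² ≤ u⁴/8 + 2A², which is (u² - 4A)² ≥ 0. Only half of the quartic term u⁴/4 of the
energy is spent, so the rest still controls the L⁴ norm. -/
theorem IsPolygonalDomain.ip_self_le (hΩ : IsPolygonalDomain Ω) {u : Plane → ℝ}
    (hu : ContinuousOn u (closure Ω)) (A : ℝ) :
    A * ip Ω u u ≤ 1 / 8 * (∫ x in Ω, u x ^ 4) + 2 * A ^ 2 * volume.real Ω := by
  have hvol : volume Ω ≠ ∞ := hΩ.isBounded.measure_lt_top.ne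
  have hc : IntegrableOn (fun _ : Plane => 2 * A ^ 2) Ω := integrableOn_const hvol
  have h : 1 / 8 * (∫ x in Ω, u x ^ 4) + 2 * A ^ 2 * volume.real Ω
      = ∫ x in Ω, (1 / 8 * u x ^ 4 + 2 * A ^ 2) := by
    rw [integral_add ((hΩ.integrableOn (by fun_prop)).const_mul _) hc, integral_const_mul,
      setIntegral_const, smul_eq_mul, mul_comm (volume.real Ω)]
  rw [h, ip, ← integral_const_mul]
  refine setIntegral_mono (hΩ.integrableOn (by fun_prop))
    (((hΩ.integrableOn (by fun_prop)).const_mul _).add hc) fun x => ?_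
  dsimp only
  nlinarith [sq_nonneg (u x ^ 2 - 4 * A)]

end norms

/-! ### Lower bound and dissipation of the energy. -/

namespace Triangulation

variable {Ω : Set Plane} {T : Triangulation Ω}

theorem energy_eq (hΩ : IsPolygonalDomain Ω) (α ε : ℝ) {u : Plane → ℝ}
    (hu : ContinuousOn u (closure Ω)) :
    energy T α ε u = 1 / 4 * (∫ x in Ω, u x ^ 4) + (1 - ε) / 2 * ip Ω u u - gradIp Ω u u
      + 1 / 2 * T.aIP α u u := by
  have hm := hΩ.aestronglyMeasurable hu
  rw [energy, normL_four_pow hm, normL_two_sq hm, normL_gradient_sq]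

/-- The energy controls the norms. -/
theorem le_energy (hΩ : IsPolygonalDomain Ω) {σ : ℝ} (hσ : 0 < σ) (hT : T.ShapeRegular σ)
    {α ε C : ℝ} (hα : 1 ≤ α) (hε : ε < 1) (hC : 0 < C) (hcoer : T.Coercive α C) {A : ℝ}
    (hA : A = 1 / (2 * (C / 4)) + 27 * (σ ^ 2 / Real.pi) / (4 * (C / 4)))
    {u : Plane → ℝ} (hu : u ∈ T.Zh) :
    1 / 8 * (∫ x in Ω, u x ^ 4) + ip Ω u u + C / 4 * T.normSq2h α u
      ≤ energy T α ε u + 2 * (A + 1) ^ 2 * volume.real Ω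
    ∧ gradIp Ω u u ≤ C / 4 * T.normSq2h α u + A * ip Ω u u := by
  -- Coercivity puts (C/2)‖u‖²_{2,h} into the energy; η = C/4 uses half of it.
  have h1 := gradIp_self_le hΩ hσ hT hα (show 0 < C / 4 by positivity) hu
  rw [← hA] at h1
  refine ⟨?_, h1⟩
  have h2 := hcoer u hu
  -- A + 1 instead of A, so that one full ‖u‖² survives on the left.
  have h3 := hΩ.ip_self_le hu.1 (A + 1)
  have h4 : 0 ≤ (1 - ε) / 2 * ip Ω u u := mul_nonneg (by linarith) (ip_self_nonneg u)
  rw [energy_eq hΩ α ε hu.1]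
  linarith

/-- One step of the scheme dissipates energy. -/
theorem energy_step (hΩ : IsPolygonalDomain Ω) {α ε C τ : ℝ} (hε : ε < 1)
    (hcoer : T.Coercive α C) (hτ : 0 < τ) {v w d μ : Plane → ℝ} (hw : w ∈ T.Zh) (hd : d ∈ T.Zh)
    (hv : v = fun x => w x + -τ * d x)
    (hevol : ip Ω d μ + gradIp Ω μ μ = 0)
    (hpot : T.aIP α w d + ip Ω (fun x => w x ^ 3 + (1 - ε) * w x) d
      - 2 * gradIp Ω v d - ip Ω μ d = 0) :
    energy T α ε w + τ * gradIp Ω μ μ + τ ^ 2 * (gradIp Ω d d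
      + 1 / 2 * ip Ω (fun x => w x * d x) (fun x => w x * d x) + C / 2 * T.normSq2h α d)
      ≤ energy T α ε v := by
  have hvZ : v ∈ T.Zh := by
    rw [hv]
    exact lagrange_add_mul hw hd _
  have hwv : w = fun x => v x + τ * d x := by
    funext x
    rw [hv]
    ring
  have hwc := hw.1
  have hdc := hd.1
  -- The implicit terms are expanded about the new iterate w and the explicit gradient term about
  -- the old iterate v. With these centres every remainder of order τ² has the favourable sign.
  have ha := aIP_add_mul α hw hd (-τ)
  have hi := ip_add_mul hΩ hw.1 hd.1 (-τ)
  have hg := gradIp_add_mul hΩ hvZ hd τ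
  rw [← hv] at ha hi
  rw [← hwv] at hg
  have hsplit : ip Ω (fun x => w x ^ 3 + (1 - ε) * w x) d
      = (∫ x in Ω, w x ^ 3 * d x) + (1 - ε) * ip Ω w d := by
    simp only [ip]
    rw [← integral_const_mul,
      ← integral_add (hΩ.integrableOn (by fun_prop)) (hΩ.integrableOn (by fun_prop))]
    congr 1
    funext x
    ring
  -- Pointwise w³(w - v) = (w⁴ - v⁴)/4 + w²(w - v)²/2 + (w² - v²)²/4 with w - v = τd; the last
  -- square is dropped.
  have hquart : 1 / 4 * (∫ x in Ω, w x ^ 4)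
        + τ ^ 2 / 2 * ip Ω (fun x => w x * d x) (fun x => w x * d x)
      ≤ 1 / 4 * (∫ x in Ω, v x ^ 4) + τ * ∫ x in Ω, w x ^ 3 * d x := by
    have hvc := hvZ.1
    simp only [ip]
    rw [← integral_const_mul, ← integral_const_mul, ← integral_const_mul, ← integral_const_mul,
      ← integral_add (hΩ.integrableOn (by fun_prop)) (hΩ.integrableOn (by fun_prop)),
      ← integral_add (hΩ.integrableOn (by fun_prop)) (hΩ.integrableOn (by fun_prop))]
    refine setIntegral_mono (hΩ.integrableOn (by fun_prop)) (hΩ.integrableOn (by fun_prop))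
      fun x => ?_
    have hx : v x = w x - τ * d x := by
      rw [hv]
      ring
    dsimp only
    rw [hx]
    nlinarith [sq_nonneg (w x ^ 2 - (w x - τ * d x) ^ 2)]
  have hsymm : ip Ω μ d = ip Ω d μ := by
    simp only [ip, mul_comm]
  have h1 : 0 ≤ (1 - ε) / 2 * (τ ^ 2 * ip Ω d d) :=
    mul_nonneg (by linarith) (mul_nonneg (sq_nonneg τ) (ip_self_nonneg d))
  have h2 := mul_le_mul_of_nonneg_left (hcoer d hd) (show 0 ≤ τ ^ 2 / 2 by positivity)
  have h3 : τ * (T.aIP α w d + ip Ω (fun x => w x ^ 3 + (1 - ε) * w x) d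
      - 2 * gradIp Ω v d - ip Ω μ d) = 0 := by rw [hpot, mul_zero]
  have h4 : τ * (ip Ω d μ + gradIp Ω μ μ) = 0 := by rw [hevol, mul_zero]
  rw [hsplit, hsymm] at h3
  rw [energy_eq hΩ α ε hw.1, energy_eq hΩ α ε hvZ.1, ha, hi, hg]
  linarith

theorem gradIp_self_nonneg (u : Plane → ℝ) : 0 ≤ gradIp Ω u u :=
  integral_nonneg fun _ => real_inner_self_nonneg

theorem dq_mem {τ : ℝ} {φ : ℕ → Plane → ℝ} {m : ℕ} (h1 : φ m ∈ T.Zh) (h0 : φ (m - 1) ∈ T.Zh) :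
    dq τ φ m ∈ T.Zh := by
  have h := lagrange_add_mul h1 h0 (-1)
  -- `lagrange_add_mul` yields only v + s w, so the multiple u/τ is written as u + (1/τ - 1)u.
  have heq : dq τ φ m = fun x => (φ m x + -1 * φ (m - 1) x)
      + (1 / τ - 1) * (φ m x + -1 * φ (m - 1) x) := by
    funext x
    rw [dq]
    ring
  rw [heq]
  exact lagrange_add_mul h h (1 / τ - 1)

/-- The energy dissipation law of the scheme. -/
theorem energy_law (hΩ : IsPolygonalDomain Ω) {α ε C τ : ℝ} (hε : ε < 1)
    (hcoer : T.Coercive α C) (hτ : 0 < τ) {M : ℕ} {φ μ : ℕ → Plane → ℝ}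
    (hsol : IsDiscreteSolution T α ε τ M φ μ) (l : ℕ) (hl : l ≤ M) :
    energy T α ε (φ l) + ∑ m ∈ Finset.Icc 1 l, (τ * gradIp Ω (μ m) (μ m)
      + τ ^ 2 * (gradIp Ω (dq τ φ m) (dq τ φ m)
        + 1 / 2 * ip Ω (fun x => φ m x * dq τ φ m x) (fun x => φ m x * dq τ φ m x)
        + C / 2 * T.normSq2h α (dq τ φ m))) ≤ energy T α ε (φ 0) := by
  induction l with
  | zero => simp
  | succ l ih =>
    rw [Finset.sum_Icc_succ_top (by omega)]
    have h1 : 1 ≤ l + 1 := by omega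
    have hZ := hsol.phi_mem (l + 1) hl
    have hZ0 : φ (l + 1 - 1) ∈ T.Zh := hsol.phi_mem l (by omega)
    have hd := dq_mem (τ := τ) hZ hZ0
    -- The test functions are ν = μ^{l+1} and ψ = δ_τ φ^{l+1}.
    have hstep := energy_step hΩ hε hcoer hτ hZ hd (v := φ l) (μ := μ (l + 1))
      (by
        funext x
        simp only [dq, Nat.add_sub_cancel]
        field_simp
        ring)
      (hsol.evolution (l + 1) h1 hl _ (hsol.mu_mem (l + 1) h1 hl))
      (hsol.potential (l + 1) h1 hl _ hd)
    have := ih (by omega)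
    linarith

end Triangulation

end PFC

end

/-! ### Assembly of the uniform bounds. -/

theorem mainTheorem4 (σ : ℝ) (hσ : 0 < σ) :
    (∃ Ccoer : ℝ, 0 < Ccoer ∧ ∃ α₁ : ℝ, 1 ≤ α₁ ∧
      ∀ Ω : Set PFC.Plane, PFC.IsPolygonalDomain Ω →
      ∀ T : PFC.Triangulation Ω, T.ShapeRegular σ →
      ∀ α : ℝ, α₁ ≤ α → T.Coercive α Ccoer) ∧
    ∀ Ω : Set PFC.Plane, PFC.IsPolygonalDomain Ω →
    ∀ Ccoer : ℝ, 0 < Ccoer → ∀ γ : ℝ, 0 < γ →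
    ∃ α₀ : ℝ, 1 ≤ α₀ ∧ ∀ α : ℝ, α₀ ≤ α →
    ∀ ε : ℝ, ε < 1 → ε < 1 + ((1 - γ) * Ccoer - 1) / Ccoer →
    ∀ C₀ : ℝ, ∃ C : ℝ,
    ∀ T : PFC.Triangulation Ω, T.ShapeRegular σ → T.Coercive α Ccoer →
    ∀ τ : ℝ, 0 < τ → ∀ M : ℕ, 1 ≤ M →
    ∀ φ μ : ℕ → PFC.Plane → ℝ, PFC.IsDiscreteSolution T α ε τ M φ μ →
    PFC.energy T α ε (φ 0) ≤ C₀ →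
      (∀ m ≤ M, PFC.normL 4 Ω (φ m) ^ 2 + PFC.normL 2 Ω (φ m) ^ 2
          + PFC.normSqH1 Ω (φ m) + T.normSq2h α (φ m) ≤ C) ∧
      ∀ l : ℕ, 1 ≤ l → l ≤ M →
        τ * ∑ m ∈ Finset.Icc 1 l, PFC.normL 2 Ω (gradient (μ m)) ^ 2 ≤ C ∧
        τ ^ 2 * ∑ m ∈ Finset.Icc 1 l,
          (PFC.normL 2 Ω (gradient (PFC.dq τ φ m)) ^ 2
            + PFC.normL 2 Ω (fun x => φ m x * PFC.dq τ φ m x) ^ 2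
            + T.normSq2h α (PFC.dq τ φ m)) ≤ C := by
  refine ⟨⟨1 / 2, by norm_num, max 1 (12 * (σ ^ 2 / Real.pi)), le_max_left _ _,
    fun Ω _ T hT α hα => PFC.Triangulation.coercive_half hσ hT ((le_max_right _ _).trans hα)⟩, ?_⟩
  intro Ω hΩ c hc γ _
  refine ⟨1, le_rfl, fun α hα ε hε _ C₀ => ?_⟩
  obtain ⟨A, hA⟩ : ∃ A : ℝ, A = 1 / (2 * (c / 4)) + 27 * (σ ^ 2 / Real.pi) / (4 * (c / 4)) :=
    ⟨_, rfl⟩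
  have hA0 : 0 ≤ A := by
    have := Real.pi_pos
    rw [hA]
    positivity
  -- The initial energy bound plus the constant lost in `le_energy`: E bounds the norms at any one
  -- time together with all the dissipation up to that time.
  set E := C₀ + 2 * (A + 1) ^ 2 * volume.real Ω with hE
  refine ⟨1 + (12 + A + 4 / c) * E, ?_⟩
  intro T hT hcoer τ hτ M _ φ μ hsol h0
  have hα0 : 0 ≤ α := by linarith
  have hterm : ∀ m, 1 ≤ m → m ≤ M →
      0 ≤ τ * PFC.gradIp Ω (μ m) (μ m) ∧ 0 ≤ PFC.gradIp Ω (PFC.dq τ φ m) (PFC.dq τ φ m) ∧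
      0 ≤ PFC.ip Ω (fun x => φ m x * PFC.dq τ φ m x) (fun x => φ m x * PFC.dq τ φ m x) ∧
      0 ≤ T.normSq2h α (PFC.dq τ φ m) := fun m _ hm2 =>
    ⟨mul_nonneg hτ.le (PFC.Triangulation.gradIp_self_nonneg _),
      PFC.Triangulation.gradIp_self_nonneg _, PFC.ip_self_nonneg _,
      PFC.Triangulation.normSq2h_nonneg hα0
        (PFC.Triangulation.dq_mem (hsol.phi_mem m hm2) (hsol.phi_mem (m - 1) (by omega)))⟩
  have hbound : ∀ l ≤ M, 1 / 8 * (∫ x in Ω, φ l x ^ 4) + PFC.ip Ω (φ l) (φ l)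
      + c / 4 * T.normSq2h α (φ l)
      + ∑ m ∈ Finset.Icc 1 l, (τ * PFC.gradIp Ω (μ m) (μ m)
      + τ ^ 2 * (PFC.gradIp Ω (PFC.dq τ φ m) (PFC.dq τ φ m)
        + 1 / 2 * PFC.ip Ω (fun x => φ m x * PFC.dq τ φ m x) (fun x => φ m x * PFC.dq τ φ m x)
        + c / 2 * T.normSq2h α (PFC.dq τ φ m))) ≤ E := fun l hl => by
    have h1 := PFC.Triangulation.energy_law hΩ hε hcoer hτ hsol l hl
    have h2 := (PFC.Triangulation.le_energy hΩ hσ hT hα hε hc hcoer hA (hsol.phi_mem l hl)).1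
    linarith
  have hQ : ∀ l, 0 ≤ ∫ x in Ω, φ l x ^ 4 := fun l =>
    integral_nonneg fun x => (show Even 4 by decide).pow_nonneg _
  have hN : ∀ l ≤ M, 0 ≤ T.normSq2h α (φ l) := fun l hl =>
    PFC.Triangulation.normSq2h_nonneg hα0 (hsol.phi_mem l hl)
  constructor
  · intro m hm
    have hm1 := hbound m hm
    have hs : 0 ≤ ∑ k ∈ Finset.Icc 1 m, (τ * PFC.gradIp Ω (μ k) (μ k)
      + τ ^ 2 * (PFC.gradIp Ω (PFC.dq τ φ k) (PFC.dq τ φ k)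
        + 1 / 2 * PFC.ip Ω (fun x => φ k x * PFC.dq τ φ k x) (fun x => φ k x * PFC.dq τ φ k x)
        + c / 2 * T.normSq2h α (PFC.dq τ φ k))) := by
      refine Finset.sum_nonneg fun k hk => ?_
      rw [Finset.mem_Icc] at hk
      obtain ⟨h1, h2, h3, h4⟩ := hterm k hk.1 (hk.2.trans hm)
      positivity
    have hgrad := (PFC.Triangulation.le_energy hΩ hσ hT hα hε hc hcoer hA (hsol.phi_mem m hm)).2
    have hmeas := hΩ.aestronglyMeasurable (hsol.phi_mem m hm).1
    have h4 := PFC.normL_four_pow hmeas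
    have hi := PFC.ip_self_nonneg (Ω := Ω) (φ m)
    have hQm := hQ m
    have hNm := mul_nonneg (show 0 ≤ c / 4 by positivity) (hN m hm)
    rw [PFC.normSqH1, PFC.normL_gradient_sq, PFC.normL_two_sq hmeas]
    -- The square of the L⁴ norm is controlled through y ≤ 1 + y², the source of the summand 1 in
    -- the final constant.
    have hL : PFC.normL 4 Ω (φ m) ^ 2 ≤ 1 + ∫ x in Ω, φ m x ^ 4 := by
      rw [← h4]
      nlinarith [sq_nonneg (PFC.normL 4 Ω (φ m) ^ 2 - 1)]
    have hAi : A * PFC.ip Ω (φ m) (φ m) ≤ A * E := mul_le_mul_of_nonneg_left (by linarith) hA0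
    have hNE : T.normSq2h α (φ m) ≤ 4 / c * E := by
      rw [div_mul_eq_mul_div, le_div_iff₀ hc]
      linarith
    linarith
  · intro l _ hl
    have hl1 := hbound l hl
    have hi := PFC.ip_self_nonneg (Ω := Ω) (φ l)
    have hQl := hQ l
    have hNl := mul_nonneg (show 0 ≤ c / 4 by positivity) (hN l hl)
    have hsum : ∑ m ∈ Finset.Icc 1 l, (τ * PFC.gradIp Ω (μ m) (μ m)
      + τ ^ 2 * (PFC.gradIp Ω (PFC.dq τ φ m) (PFC.dq τ φ m)
        + 1 / 2 * PFC.ip Ω (fun x => φ m x * PFC.dq τ φ m x) (fun x => φ m x * PFC.dq τ φ m x)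
        + c / 2 * T.normSq2h α (PFC.dq τ φ m))) ≤ E := by linarith
    have h4c : 0 < 4 / c := by positivity
    have hE0 : 0 ≤ E := le_trans (Finset.sum_nonneg fun k hk => by
      rw [Finset.mem_Icc] at hk
      obtain ⟨h1, h2, h3, h4⟩ := hterm k hk.1 (hk.2.trans hl)
      positivity) hsum
    have hAE := mul_nonneg hA0 hE0
    have hcE := mul_nonneg h4c.le hE0
    constructor
    · refine le_trans (b := E) (le_trans ?_ hsum) (by linarith)
      rw [Finset.mul_sum]
      refine Finset.sum_le_sum fun k hk => ?_
      rw [Finset.mem_Icc] at hk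
      obtain ⟨h1, h2, h3, h4⟩ := hterm k hk.1 (hk.2.trans hl)
      rw [PFC.normL_gradient_sq]
      have : 0 ≤ τ ^ 2 * (PFC.gradIp Ω (PFC.dq τ φ k) (PFC.dq τ φ k)
        + 1 / 2 * PFC.ip Ω (fun x => φ k x * PFC.dq τ φ k x) (fun x => φ k x * PFC.dq τ φ k x)
        + c / 2 * T.normSq2h α (PFC.dq τ φ k)) := by positivity
      linarith
    -- The factor 2 + 4/c makes each of the weights 1, 1/2 and c/2 of the dissipation at least 1.
    · refine le_trans (b := (2 + 4 / c) * E)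
        (le_trans ?_ (mul_le_mul_of_nonneg_left hsum (by positivity))) (by linarith)
      rw [Finset.mul_sum, Finset.mul_sum]
      refine Finset.sum_le_sum fun k hk => ?_
      rw [Finset.mem_Icc] at hk
      obtain ⟨h1, h2, h3, h4⟩ := hterm k hk.1 (hk.2.trans hl)
      have hd := PFC.Triangulation.dq_mem (τ := τ) (hsol.phi_mem k (hk.2.trans hl))
        (hsol.phi_mem (k - 1) (by omega))
      have hmeas := hΩ.aestronglyMeasurable
        ((hsol.phi_mem k (hk.2.trans hl)).1.fun_mul hd.1)
      rw [PFC.normL_gradient_sq, PFC.normL_two_sq hmeas]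
      set X := PFC.gradIp Ω (PFC.dq τ φ k) (PFC.dq τ φ k)
      set Y := PFC.ip Ω (fun x => φ k x * PFC.dq τ φ k x) (fun x => φ k x * PFC.dq τ φ k x)
      set Z := T.normSq2h α (PFC.dq τ φ k)
      have hXYZ : X + Y + Z ≤ (2 + 4 / c) * (X + 1 / 2 * Y + c / 2 * Z) := by
        have : (2 + 4 / c) * (X + 1 / 2 * Y + c / 2 * Z) - (X + Y + Z)
            = X + Z + c * Z + 4 / c * X + 2 / c * Y := by
          field_simp
          ring
        have h5 : 0 ≤ X + Z + c * Z + 4 / c * X + 2 / c * Y := by positivity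
        linarith
      have h6 := mul_le_mul_of_nonneg_left hXYZ (sq_nonneg τ)
      have h7 := mul_nonneg (show 0 ≤ 2 + 4 / c by positivity) h1
      linarith
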